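/- Let $K$ be a field with a derivation $\partial$, let $n\ge 1$, let $X=\{x_1,\dots,x_n\}$ and $U=\{u_1,\dots,u_{n-1}\}$ be differential indeterminates over $K$, and write $x_{ik}=\partial^k x_i$, $u_{jk}=\partial^k u_j$. Consider a system of linear differential polynomial parametric equations $$x_1=P_1(U),\ \dots,\ x_n=P_n(U),$$ where $P_1,\dots,P_n\in K\{U\}$ have total degree at most $1$, not all $P_i$ lie in $K$, and every $u_j$ or one of its derivatives occurs in some $P_i$. Let $a_i\in K$ be the constant term of $P_i$, and put $H_i(U)=a_i-P_i(U)$ and $F_i(X,U)=x_i-P_i(U)=x_i-a_i+H_i(U)$. Let $o_i$ be the order of $H_i$ (the largest $k$ such that some $u_{jk}$ occurs in $H_i$, and $0$ if $H_i=0$), and $N=\sum_{i=1}^n o_i$. Let $L=(n-1)N+n$. The differential resultant $\partial\mathrm{Res}(F_1,\dots,F_n)\in K\{X\}$ is the determinant of the $L\times L$ matrix whose rows are the coefficients, as polynomials in $U$ over $K\{X\}$, of $\partial^{N-o_1}F_1,\dots,\partial F_1,F_1,\ \dots,\ \partial^{N-o_n}F_n,\dots,\partial F_n,F_n$ (in this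 order), the columns corresponding to $u_{n-1,N},\dots,u_{1,N},\,u_{n-1,N-1},\dots,u_{1,N-1},\ \dots,\ u_{n-1,0},\dots,u_{1,0},\,1$ (in this order). The differential homogeneous resultant $\partial\mathrm{Res}^h(H_1,\dots,H_n)\in K$ is the determinant of the $(n-1)N\times(n-1)N$ matrix whose rows are the coefficients of $\partial^{N-o_1-1}H_1,\dots,H_1,\ \dots,\ \partial^{N-o_n-1}H_n,\dots,H_n$ (there is no row from $H_i$ if $N=o_i$), the columns corresponding to $u_{n-1,N-1},\dots,u_{1,N-1},\ \dots,\ u_{n-1,0},\dots,u_{1,0}$. Let $\mathrm{ID}=\{f\in K\{X\} : f(P_1(U),\dots,P_n(U))=0\}$ be the implicit ideal of the system. Fix any ranking of the derivatives $x_{ik}$, i.e. a total order with $v<\partial v$ for all $v$, and $\partial v<\partial w$ whenever $v<w$. A characteristic set of $\mathrm{ID}$ is an autoreduced set contained in $\mathrm{ID}$ of lowest rank among such sets. The ideal $\mathrm{ID}$ has dimension $d$ if it has a characteristic set and $n-|\mathcal C|=d$ for each characteristic set $\mathcal C$ of $\mathrm{ID}$. If $\mathrm{ID}$ has dimension $n-1$,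 then $A(X)=0$ is called the implicit equation of the system if $A\in K\{X\}$ is irreducible and $\{A\}$ is a characteristic set of $\mathrm{ID}$. **Theorem.** Suppose that $\partial\mathrm{Res}^h(H_1,\dots,H_n)\neq 0$; in the degenerate case $N=0$, in which the matrix of $\partial\mathrm{Res}^h$ is empty (and its determinant is $1$), suppose moreover that $\partial\mathrm{Res}(F_1,\dots,F_n)\ne 0$. Then $\mathrm{ID}$ has dimension $n-1$, and $$\partial\mathrm{Res}(F_1,\dots,F_n)(X)=0$$ is the implicit equation of the system. -/

import Mathlib

open scoped Differential

noncomputable section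

namespace DiffElim

/-! ### Differential polynomials -/

/-- The ring `R{Y}` of ordinary differential polynomials over `R` in the differential
indeterminates `y_i`, `i : σ`: the polynomial ring in the variables `(i, k)`, where `(i, k)` is the
`k`-th derivative of `y_i`. -/
abbrev DiffPoly (R : Type*) [CommRing R] (σ : Type*) : Type _ := MvPolynomial (σ × ℕ) R

section derivation

variable {R : Type*} [CommRing R] [Differential R] {σ : Type*}

/-- The derivation of `R` applied to all coefficients of a polynomial. -/
def coeffDeriv {τ : Type*} (f : MvPolynomial τ R) : MvPolynomial τ R :=
  ∑ s ∈ f.support, MvPolynomial.monomial s (MvPolynomial.coeff s f)′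

theorem coeff_coeffDeriv {τ : Type*} (f : MvPolynomial τ R) (s : τ →₀ ℕ) :
    MvPolynomial.coeff s (coeffDeriv f) = (MvPolynomial.coeff s f)′ := by
  classical
  simp only [coeffDeriv, MvPolynomial.coeff_sum, MvPolynomial.coeff_monomial,
    Finset.sum_ite_eq', MvPolynomial.mem_support_iff]
  split_ifs with h
  · rfl
  · rw [not_not.1 h, map_zero]

/-- `coeffDeriv` as a derivation. -/
def coeffDerivation {τ : Type*} : Derivation ℤ (MvPolynomial τ R) (MvPolynomial τ R) :=
  Derivation.mk'
    (AddMonoidHom.toIntLinearMap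
      { toFun := coeffDeriv
        map_zero' := by ext s; simp [coeff_coeffDeriv]
        map_add' := fun f g => by ext s; simp [coeff_coeffDeriv] })
    (fun f g => by
      classical
      ext s
      simp only [AddMonoidHom.coe_toIntLinearMap, AddMonoidHom.coe_mk, ZeroHom.coe_mk,
        coeff_coeffDeriv, MvPolynomial.coeff_mul, map_sum, Derivation.leibniz, smul_eq_mul,
        MvPolynomial.coeff_add, Finset.sum_add_distrib]
      congr 1
      exact Finset.sum_nbij' Prod.swap Prod.swap (by simp [add_comm]) (by simp [add_comm])
        (by simp) (by simp) (by simp))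

/-- The derivation of `R{Y}`: it extends the derivation of `R` and maps `y_{i,k}` to
`y_{i,k+1}`. -/
instance instDifferentialDiffPoly : Differential (DiffPoly R σ) where
  deriv := coeffDerivation +
    (MvPolynomial.mkDerivation R fun v : σ × ℕ =>
      (MvPolynomial.X (v.1, v.2 + 1) : DiffPoly R σ)).restrictScalars ℤ

theorem deriv_X (v : σ × ℕ) :
    (MvPolynomial.X v : DiffPoly R σ)′ = MvPolynomial.X (v.1, v.2 + 1) := by
  classical
  have h : coeffDeriv (MvPolynomial.X v : DiffPoly R σ) = 0 := by
    ext s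
    rw [coeff_coeffDeriv, MvPolynomial.coeff_X]
    split_ifs <;> simp
  change coeffDeriv (MvPolynomial.X v : DiffPoly R σ) + MvPolynomial.mkDerivation R _ _ = _
  rw [h, zero_add, MvPolynomial.mkDerivation_X]

theorem deriv_C (a : R) :
    (MvPolynomial.C a : DiffPoly R σ)′ = MvPolynomial.C a′ := by
  classical
  have h : coeffDeriv (MvPolynomial.C a : DiffPoly R σ) = MvPolynomial.C a′ := by
    ext s
    rw [coeff_coeffDeriv, MvPolynomial.coeff_C, MvPolynomial.coeff_C]
    split_ifs <;> simp
  change coeffDeriv (MvPolynomial.C a : DiffPoly R σ) +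
    MvPolynomial.mkDerivation R _ (MvPolynomial.C a) = _
  rw [h, MvPolynomial.derivation_C, add_zero]

end derivation

/-- The order of a differential polynomial: the largest `k` such that some `y_{i,k}` occurs in it
(and `0` if no indeterminate occurs). -/
def order {R : Type*} [CommRing R] {σ : Type*} (f : DiffPoly R σ) : ℕ := f.vars.sup Prod.snd

/-! ### The differential resultants of `n = m + 1` linear differential polynomials in `m`
differential variables -/

section resultant

variable {m : ℕ} {R : Type*} [CommRing R] (f : Fin (m + 1) → DiffPoly R (Fin m))

/-- `N = o_1 + ⋯ + o_n`, where `o_i` is the order of `f_i`. -/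
def totalOrder : ℕ := ∑ i, order (f i)

theorem order_le_totalOrder (i : Fin (m + 1)) : order (f i) ≤ totalOrder f :=
  Finset.single_le_sum (f := fun i => order (f i)) (fun _ _ => Nat.zero_le _) (Finset.mem_univ i)

theorem sum_totalOrder_sub :
    ∑ i, (totalOrder f - order (f i)) = totalOrder f * m := by
  have h : ∑ i, (totalOrder f - order (f i)) + totalOrder f = totalOrder f * m + totalOrder f := by
    conv_lhs => rw [totalOrder]
    rw [← Finset.sum_add_distrib]
    change ∑ i, (totalOrder f - order (f i) + order (f i)) = _
    rw [Finset.sum_congr rfl fun i _ => Nat.sub_add_cancel (order_le_totalOrder f i)]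
    simp only [Finset.sum_const, Finset.card_univ, Fintype.card_fin, smul_eq_mul]
    ring
  exact Nat.add_right_cancel h

theorem sum_totalOrder_sub_add_one :
    ∑ i, (totalOrder f - order (f i) + 1) = (totalOrder f + 1) * m + 1 := by
  rw [Finset.sum_add_distrib, sum_totalOrder_sub]
  simp only [Finset.sum_const, Finset.card_univ, Fintype.card_fin, smul_eq_mul]
  ring

variable [Differential R]

/-- The polynomials of `PS(f_1, …, f_n)` in the order of the rows of `M(L)`:
`∂^{N-o_1} f_1, …, ∂ f_1, f_1, ∂^{N-o_2} f_2, …, f_2, …, ∂^{N-o_n} f_n, …, f_n`. -/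
def resRow (k : Fin ((totalOrder f + 1) * m + 1)) : DiffPoly R (Fin m) :=
  let p : (i : Fin (m + 1)) × Fin (totalOrder f - order (f i) + 1) :=
    finSigmaFinEquiv.symm (finCongr (sum_totalOrder_sub_add_one f).symm k)
  (Differential.deriv : DiffPoly R (Fin m) → DiffPoly R (Fin m))^[(p.2.rev : ℕ)] (f p.1)

/-- The polynomials of `PS^h(f_1, …, f_n)` in the order of the rows of `M(L^h)`:
`∂^{N-o_1-1} f_1, …, f_1, ∂^{N-o_2-1} f_2, …, f_2, …, ∂^{N-o_n-1} f_n, …, f_n`. -/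
def homResRow (k : Fin (totalOrder f * m)) : DiffPoly R (Fin m) :=
  let p : (i : Fin (m + 1)) × Fin (totalOrder f - order (f i)) :=
    finSigmaFinEquiv.symm (finCongr (sum_totalOrder_sub f).symm k)
  (Differential.deriv : DiffPoly R (Fin m) → DiffPoly R (Fin m))^[(p.2.rev : ℕ)] (f p.1)

/-- The derivatives `u_{j,k}`, `k < M`, in decreasing order for the orderly ranking with
`u_1 < ⋯ < u_m`: `u_{m,M-1}, …, u_{1,M-1}, u_{m,M-2}, …, u_{1,M-2}, …, u_{m,0}, …, u_{1,0}`. -/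
def orderlyVar (m M : ℕ) (c : Fin (M * m)) : Fin m × ℕ :=
  let q : Fin M × Fin m := finProdFinEquiv.symm c
  (q.2.rev, (q.1.rev : ℕ))

/-- The differential resultant matrix `M(L)`, of size `L = (n-1) N + n = (N+1) (n-1) + 1`: its
rows are the coefficients of the polynomials of `PS(f_1, …, f_n)` at the `u_{j,k}`, `k ≤ N`, in
decreasing order, and, in the last column, at the monomial `1`. -/
def resMatrix : Matrix (Fin ((totalOrder f + 1) * m + 1)) (Fin ((totalOrder f + 1) * m + 1)) R :=
  Matrix.of fun r c =>
    Sum.elim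
      (fun c' => MvPolynomial.coeff (Finsupp.single (orderlyVar m (totalOrder f + 1) c') 1)
        (resRow f r))
      (fun _ => MvPolynomial.coeff 0 (resRow f r))
      (finSumFinEquiv.symm c : Fin ((totalOrder f + 1) * m) ⊕ Fin 1)

/-- The differential homogeneous resultant matrix `M(L^h)`, of size `L^h = (n-1) N`: its rows are
the coefficients of the polynomials of `PS^h(f_1, …, f_n)` at the `u_{j,k}`, `k ≤ N - 1`, in
decreasing order. -/
def homResMatrix : Matrix (Fin (totalOrder f * m)) (Fin (totalOrder f * m)) R :=
  Matrix.of fun r c =>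
    MvPolynomial.coeff (Finsupp.single (orderlyVar m (totalOrder f) c) 1) (homResRow f r)

/-- The differential resultant `∂Res(f_1, …, f_n)` of differential polynomials of degree at most
one. -/
def diffRes : R := (resMatrix f).det

/-- The differential homogeneous resultant `∂Res^h(f_1, …, f_n)` of homogeneous differential
polynomials of degree one. -/
def homDiffRes : R := (homResMatrix f).det

end resultant

/-! ### Systems `x_i = P_i(U)` -/

section system

variable {K : Type*} [Field K] {n m : ℕ} (P : Fin n → DiffPoly K (Fin m))

/-- `H_i(U) = a_i - P_i(U)`, where `a_i` is the constant term of `P_i`. -/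
def homPart (i : Fin n) : DiffPoly K (Fin m) :=
  MvPolynomial.C (MvPolynomial.coeff 0 (P i)) - P i

/-- `F_i(X, U) = x_i - P_i(U)`, as a differential polynomial in `U` over `K{X}`. -/
def implicitForm (i : Fin n) : DiffPoly (DiffPoly K (Fin n)) (Fin m) :=
  MvPolynomial.C (MvPolynomial.X (i, 0)) - MvPolynomial.map MvPolynomial.C (P i)

variable [Differential K]

/-- The substitution `f(X) ↦ f(P_1(U), …, P_n(U))` of differential polynomials,
`x_{i,k} ↦ ∂^k P_i(U)`. -/
def diffSubst : DiffPoly K (Fin n) →ₐ[K] DiffPoly K (Fin m) :=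
  MvPolynomial.aeval fun v : Fin n × ℕ =>
    (Differential.deriv : DiffPoly K (Fin m) → DiffPoly K (Fin m))^[v.2] (P v.1)

/-- The implicit ideal `ID = {f ∈ K{X} | f(P_1(U), …, P_n(U)) = 0}`. -/
def implicitIdeal : Ideal (DiffPoly K (Fin n)) := RingHom.ker (diffSubst P)

end system

/-! ### Rankings, chains, characteristic sets -/

/-- A ranking on the differential indeterminates `y_i`, `i : σ`: a total order on their
derivatives with `v < ∂v`, and `∂v < ∂w` whenever `v < w`. -/
structure Ranking (σ : Type*) where
  lt : σ × ℕ → σ × ℕ → Prop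
  isStrictTotalOrder : IsStrictTotalOrder (σ × ℕ) lt
  lt_deriv : ∀ i k, lt (i, k) (i, k + 1)
  deriv_lt_deriv : ∀ i k j l, lt (i, k) (j, l) → lt (i, k + 1) (j, l + 1)

section charSet

variable {K : Type*} [Field K] {σ : Type*} (r : Ranking σ)

/-- `v` is the lead of `f`: the highest derivative that occurs in `f`. Elements of `K` have no
lead. -/
def IsLead (f : DiffPoly K σ) (v : σ × ℕ) : Prop :=
  v ∈ f.vars ∧ ∀ w ∈ f.vars, w ≠ v → r.lt w v

/-- `f` has lower rank than `g`, for `f, g ∉ K`. -/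
def RankLT (f g : DiffPoly K σ) : Prop :=
  ∃ v w, IsLead r f v ∧ IsLead r g w ∧
    (r.lt v w ∨ v = w ∧ MvPolynomial.degreeOf v f < MvPolynomial.degreeOf v g)

/-- `f` and `g` have the same rank, for `f, g ∉ K`. -/
def RankEq (f g : DiffPoly K σ) : Prop :=
  ∃ v, IsLead r f v ∧ IsLead r g v ∧ MvPolynomial.degreeOf v f = MvPolynomial.degreeOf v g

/-- `f` is reduced with respect to `g ∉ K`: if `v` is the lead of `g`, no proper derivative of `v`
occurs in `f`, and `f` has smaller degree in `v` than `g`. -/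
def IsReduced (f g : DiffPoly K σ) : Prop :=
  ∃ v, IsLead r g v ∧ (∀ l, v.2 < l → (v.1, l) ∉ f.vars) ∧
    MvPolynomial.degreeOf v f < MvPolynomial.degreeOf v g

/-- A chain (autoreduced set) `A_1, …, A_t` of differential polynomials outside `K`: they are
listed by increasing rank, and each is reduced with respect to the preceding ones. -/
def IsChain (A : List (DiffPoly K σ)) : Prop :=
  (∀ f ∈ A, ∃ v, IsLead r f v) ∧ A.Pairwise fun f g => RankLT r f g ∧ IsReduced r g f

/-- `A` is a chain of lower rank than `B`: either `A_i`, `B_i` have the same rank for `i < j` and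
`A_j` has lower rank than `B_j`, or `A` is longer than `B` and `A_i`, `B_i` have the same rank for
all `i` up to the length of `B`. -/
def ChainLT : List (DiffPoly K σ) → List (DiffPoly K σ) → Prop
  | [], _ => False
  | _ :: _, [] => True
  | f :: A, g :: B => RankLT r f g ∨ RankEq r f g ∧ ChainLT A B

/-- `A` is a characteristic set of the ideal `I`: a chain in `I` such that no chain in `I` has
lower rank. -/
def IsCharSet (I : Ideal (DiffPoly K σ)) (A : List (DiffPoly K σ)) : Prop :=
  (IsChain r A ∧ ∀ f ∈ A, f ∈ I) ∧
    ∀ B : List (DiffPoly K σ), IsChain r B → (∀ f ∈ B, f ∈ I) → ¬ ChainLT r B A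

/-- The differential ideal `I` of `K{x_1, …, x_n}` has (differential) dimension `d`: it has
characteristic sets, and `d = n - |A|` for each of them. -/
def HasDiffDim {n : ℕ} (r : Ranking (Fin n)) (I : Ideal (DiffPoly K (Fin n))) (d : ℕ) : Prop :=
  (∃ A, IsCharSet r I A) ∧ ∀ A, IsCharSet r I A → A.length + d = n

/-- `A` is a characteristic polynomial of `I`: it is irreducible and `{A}` is a characteristic set
of `I`. -/
def IsCharPoly (I : Ideal (DiffPoly K σ)) (A : DiffPoly K σ) : Prop :=
  Irreducible A ∧ IsCharSet r I [A]

/-- `A(X) = 0` is the implicit equation of the system `x_i = P_i(U)`, `i = 1, …, n`: the implicit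
ideal has dimension `n - 1` and `A` is a characteristic polynomial of it. -/
def IsImplicitEquation [Differential K] {m : ℕ} (r : Ranking (Fin (m + 1)))
    (P : Fin (m + 1) → DiffPoly K (Fin m)) (A : DiffPoly K (Fin (m + 1))) : Prop :=
  HasDiffDim r (implicitIdeal P) m ∧ IsCharPoly r (implicitIdeal P) A

end charSet

end DiffElim

end

/-!
Write `P_i = a_i - h_i` with `a_i ∈ K` and linear forms `h_i` of order `o_i`, and call a linear form
`Q = ∑ q_{i,k} x_{i,k}` over `K` a relation if `∑ q_{i,k} ∂^k h_i = 0` (`substForm`). Give `x_{i,k}`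
the weight `k + o_i`. The nonvanishing of the homogeneous resultant says that the `∂^k h_i` of weight
less than `N` form a basis of the linear forms in the `u_{j,k}`, `k < N`. In particular there is no
nonzero relation of weight less than `N`, and the `n × (n - 1)` matrix `S` of the coefficients of
`u_{j,o_i}` in `h_i` has rank `n - 1` (for `N = 0`, where `∂Res` is essentially an extension of `S`
by one column, this is what the nonvanishing of `∂Res` gives).

Expanding `D = ∂Res(F_1, …, F_n)` along its last column shows that `D` is an affine form over `K`
whose linear part `Q₀` is a relation of weight at most `N`, and that `Q₀ ≠ 0` because the other
columns are independent (`diffRes_affineSystem`). Hence `D` lies in the implicit ideal, and it is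
irreducible, being of degree one.

The coefficients of highest weight `T ≥ N` of a relation form a vector in the left kernel of `S`.
This kernel is a line, spanned by the coefficients of weight `N` of `Q₀`, so subtracting a multiple
of `∂^(T - N) Q₀` lowers the weight. Hence every relation is a combination of the derivatives
of `Q₀` (`exists_linearCombination_iterate_formDeriv`).

Now let `v` be the lead of `D` for any ranking. The lead of `∂^l Q₀` is `∂^l v`, so every nonzero
relation involves some `∂^s v`. In other words, the `∂^k h_i` with `x_{i,k}` not among the `∂^s v`
are linearly independent, and therefore the `∂^k P_i` with these indices are algebraically
independent (`eq_zero_of_mem_implicitIdeal`). So every element of the implicit ideal outside `K`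
involves some `∂^s v`, which leaves no room for a chain of rank lower than that of `D` and forces
every characteristic set to have one element (`isCharSet_singleton`, `length_eq_one_of_isCharSet`).
-/

noncomputable section

namespace DiffElim

/-! ### Linear forms in differential indeterminates -/

section linearForms

variable {R : Type*} [CommRing R]

/-- The linear form `∑ c_v y_v` with coefficient vector `c`. -/
def linForm {τ : Type*} : (τ →₀ R) →ₗ[R] MvPolynomial τ R :=
  Finsupp.linearCombination R (MvPolynomial.X : τ → MvPolynomial τ R)

theorem linForm_single {τ : Type*} (v : τ) (a : R) :
    linForm (Finsupp.single v a) = MvPolynomial.C a * MvPolynomial.X v := by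
  simp [linForm, MvPolynomial.smul_eq_C_mul]

theorem coeff_single_linForm {τ : Type*} (c : τ →₀ R) (v : τ) :
    MvPolynomial.coeff (Finsupp.single v 1) (linForm c) = c v := by
  classical
  induction c using Finsupp.induction_linear with
  | zero => simp
  | add f g hf hg => simp [hf, hg]
  | single w a =>
    rw [linForm_single, MvPolynomial.coeff_C_mul, MvPolynomial.coeff_X, Finsupp.single_apply]
    simp [Finsupp.single_left_inj]

theorem coeff_zero_linForm {τ : Type*} (c : τ →₀ R) : MvPolynomial.coeff 0 (linForm c) = 0 := by
  classical
  induction c using Finsupp.induction_linear with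
  | zero => simp
  | add f g hf hg => simp [hf, hg]
  | single w a =>
    rw [linForm_single, MvPolynomial.coeff_C_mul, MvPolynomial.coeff_X]
    simp

theorem totalDegree_C_add_linForm_le {τ : Type*} (a : R) (c : τ →₀ R) :
    (MvPolynomial.C a + linForm c).totalDegree ≤ 1 := by
  refine (MvPolynomial.totalDegree_add _ _).trans (max_le (by simp) ?_)
  rw [linForm, Finsupp.linearCombination_apply]
  refine MvPolynomial.totalDegree_finsetSum_le fun v _ => ?_
  refine (MvPolynomial.totalDegree_smul_le _ _).trans ?_
  exact MvPolynomial.totalDegree_monomial_le (Finsupp.single v 1) (1 : R) |>.trans (by simp)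

theorem vars_C_add_linForm {τ : Type*} (a : R) (c : τ →₀ R) :
    (MvPolynomial.C a + linForm c).vars = c.support := by
  classical
  ext v
  rw [MvPolynomial.mem_vars_iff_mem_support, Finsupp.mem_support_iff]
  constructor
  · rintro ⟨d, hd, hv⟩
    -- an exponent of degree at most one that involves `v` is the one of `y_v`
    have hdeg : d.sum (fun _ e => e) ≤ 1 :=
      (MvPolynomial.le_totalDegree hd).trans (totalDegree_C_add_linForm_le a c)
    have hv0 : d v ≠ 0 := Finsupp.mem_support_iff.1 hv
    have hd1 : d = Finsupp.single v 1 := by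
      have hle : Finsupp.single v 1 ≤ d := by
        rw [Finsupp.single_le_iff]; omega
      obtain ⟨e, rfl⟩ := exists_add_of_le hle
      rw [Finsupp.sum_add_index' (by simp) (by simp), Finsupp.sum_single_index rfl] at hdeg
      have : e.sum (fun _ e => e) = 0 := by omega
      have he : e = 0 := by
        ext w
        by_contra hw
        have := (Finset.sum_eq_zero_iff.1 this) w (Finsupp.mem_support_iff.2 hw)
        exact hw this
      rw [he, add_zero]
    subst hd1
    rw [MvPolynomial.mem_support_iff, MvPolynomial.coeff_add, coeff_single_linForm,
      MvPolynomial.coeff_C, if_neg (by simp [eq_comm]), zero_add] at hd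
    exact hd
  · intro hv
    refine ⟨Finsupp.single v 1, ?_, by simp⟩
    rw [MvPolynomial.mem_support_iff, MvPolynomial.coeff_add, coeff_single_linForm,
      MvPolynomial.coeff_C, if_neg (by simp [eq_comm]), zero_add]
    exact hv

theorem exists_eq_C_add_linForm {τ : Type*} {f : MvPolynomial τ R} (hf : f.totalDegree ≤ 1) :
    ∃ c : τ →₀ R, f = MvPolynomial.C (MvPolynomial.coeff 0 f) + linForm c := by
  classical
  refine ⟨Finsupp.onFinset f.vars (fun v => MvPolynomial.coeff (Finsupp.single v 1) f) ?_, ?_⟩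
  · intro v hv
    exact (MvPolynomial.mem_vars_iff_mem_support v).2
      ⟨_, MvPolynomial.mem_support_iff.2 hv, by simp⟩
  · ext d
    rw [MvPolynomial.coeff_add]
    by_cases h0 : d = 0
    · subst h0
      simp [coeff_zero_linForm]
    by_cases h1 : ∃ v, d = Finsupp.single v 1
    · obtain ⟨v, rfl⟩ := h1
      rw [coeff_single_linForm, MvPolynomial.coeff_C, if_neg (by simp [eq_comm])]
      simp
    -- the remaining exponents have degree at least two
    have hdeg : 1 < d.sum (fun _ e => e) := by
      obtain ⟨v, hv⟩ := Finsupp.ne_iff.1 h0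
      have hle : Finsupp.single v 1 ≤ d := by
        rw [Finsupp.single_le_iff]; simp at hv; omega
      obtain ⟨e, rfl⟩ := exists_add_of_le hle
      obtain ⟨w, hw⟩ : ∃ w, e w ≠ 0 := by
        by_contra! h
        exact h1 ⟨v, by ext w; simp [h]⟩
      rw [Finsupp.sum_add_index' (by simp) (by simp), Finsupp.sum_single_index rfl]
      have : e w ≤ e.sum (fun _ e => e) :=
        Finset.single_le_sum (f := fun w => e w) (fun _ _ => Nat.zero_le _)
          (Finsupp.mem_support_iff.2 hw)
      omega
    have hz : ∀ g : MvPolynomial τ R, g.totalDegree ≤ 1 → MvPolynomial.coeff d g = 0 := by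
      intro g hg
      by_contra hne
      have := MvPolynomial.le_totalDegree (MvPolynomial.mem_support_iff.2 hne)
      omega
    rw [hz f hf, ← MvPolynomial.coeff_add, hz _ (totalDegree_C_add_linForm_le _ _)]

theorem map_linForm {S τ : Type*} [CommRing S] (φ : R →+* S) (c : τ →₀ R) :
    MvPolynomial.map φ (linForm c) = linForm (c.mapRange φ (map_zero φ)) := by
  classical
  induction c using Finsupp.induction_linear with
  | zero => simp
  | add f g hf hg => rw [map_add, map_add, hf, hg, Finsupp.mapRange_add (map_add φ), map_add]
  | single w a => simp [linForm_single]

theorem linForm_smul {τ : Type*} (b : R) (c : τ →₀ R) :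
    linForm (b • c) = MvPolynomial.C b * linForm c := by
  rw [map_smul, MvPolynomial.smul_eq_C_mul]

theorem irreducible_C_add_linForm {K τ : Type*} [Field K] (b : K) {c : τ →₀ K} (hc : c ≠ 0) :
    Irreducible (MvPolynomial.C b + linForm c) := by
  obtain ⟨v, hv⟩ := Finsupp.ne_iff.1 hc
  have hcoeff : MvPolynomial.coeff (Finsupp.single v 1) (MvPolynomial.C b + linForm c) = c v := by
    classical
    rw [MvPolynomial.coeff_add, coeff_single_linForm, MvPolynomial.coeff_C,
      if_neg (by simp [eq_comm]), zero_add]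
  refine MvPolynomial.irreducible_of_totalDegree_eq_one
    (le_antisymm (totalDegree_C_add_linForm_le b c) ?_) fun x hx => ?_
  · have := MvPolynomial.le_totalDegree (p := MvPolynomial.C b + linForm c)
      (s := Finsupp.single v 1) (by rw [MvPolynomial.mem_support_iff, hcoeff]; exact hv)
    simpa using this
  · refine isUnit_of_dvd_unit (hx (Finsupp.single v 1)) ?_
    rw [hcoeff]
    exact IsUnit.mk0 _ hv

end linearForms

section formDeriv

variable {R : Type*} [CommRing R] [Differential R] {σ : Type*}

/-- The effect of the derivation of `R{Y}` on coefficient vectors of linear forms: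
`∂ (∑ c_{i,k} y_{i,k}) = ∑ (c_{i,k}′ y_{i,k} + c_{i,k} y_{i,k+1})`. -/
def formDeriv : (σ × ℕ →₀ R) →+ (σ × ℕ →₀ R) :=
  Finsupp.mapRange.addMonoidHom (Differential.deriv : Derivation ℤ R R).toLinearMap.toAddMonoidHom +
    Finsupp.mapDomain.addMonoidHom fun v : σ × ℕ => (v.1, v.2 + 1)

theorem formDeriv_apply_zero (c : σ × ℕ →₀ R) (i : σ) : formDeriv c (i, 0) = (c (i, 0))′ := by
  simp only [formDeriv, AddMonoidHom.add_apply, Finsupp.add_apply,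
    Finsupp.mapDomain.addMonoidHom_apply]
  rw [Finsupp.mapDomain_of_notMem_range _ _ (by simp), add_zero]
  simp

theorem formDeriv_apply_succ (c : σ × ℕ →₀ R) (i : σ) (k : ℕ) :
    formDeriv c (i, k + 1) = (c (i, k + 1))′ + c (i, k) := by
  have hinj : Function.Injective fun v : σ × ℕ => (v.1, v.2 + 1) := by
    rintro ⟨a, b⟩ ⟨a', b'⟩ h
    simpa using h
  simp only [formDeriv, AddMonoidHom.add_apply, Finsupp.add_apply,
    Finsupp.mapDomain.addMonoidHom_apply]
  congr 1
  exact Finsupp.mapDomain_apply hinj c (i, k)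

theorem formDeriv_single (v : σ × ℕ) (a : R) :
    formDeriv (Finsupp.single v a) = Finsupp.single v a′ + Finsupp.single (v.1, v.2 + 1) a := by
  simp [formDeriv]

theorem deriv_linForm (c : σ × ℕ →₀ R) : (linForm c)′ = linForm (formDeriv c) := by
  induction c using Finsupp.induction_linear with
  | zero => simp
  | add f g hf hg => simp [hf, hg]
  | single w a =>
    rw [formDeriv_single, map_add, linForm_single, linForm_single, linForm_single,
      Derivation.leibniz, deriv_X, deriv_C]
    simp only [smul_eq_mul]
    ring

theorem iterate_deriv_C_add_linForm (a : R) (c : σ × ℕ →₀ R) (k : ℕ) :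
    (Differential.deriv : DiffPoly R σ → DiffPoly R σ)^[k] (MvPolynomial.C a + linForm c) =
      MvPolynomial.C ((Differential.deriv : R → R)^[k] a) + linForm (formDeriv^[k] c) := by
  induction k with
  | zero => rfl
  | succ k ih =>
    rw [Function.iterate_succ_apply', ih, map_add, deriv_C, deriv_linForm,
      Function.iterate_succ_apply', Function.iterate_succ_apply']

theorem iterate_formDeriv_mapRange {S : Type*} [CommRing S] [Differential S] (φ : R →+* S)
    (hφ : ∀ a, (φ a)′ = φ a′) (c : σ × ℕ →₀ R) (k : ℕ) :
    formDeriv^[k] (c.mapRange φ (map_zero φ)) = (formDeriv^[k] c).mapRange φ (map_zero φ) := by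
  induction k with
  | zero => rfl
  | succ k ih =>
    rw [Function.iterate_succ_apply', ih, Function.iterate_succ_apply']
    ext ⟨i, l⟩
    cases l with
    | zero => simp [formDeriv_apply_zero, hφ]
    | succ l => simp [formDeriv_apply_succ, hφ]

/-- If `c` lives in weights `k + o_i ≤ B`, then `∂^l c` lives in weights `≤ B + l`. -/
theorem iterate_formDeriv_eq_zero_of_weight (o : σ → ℕ) {B : ℕ} (c : σ × ℕ →₀ R)
    (hc : ∀ i k, B < k + o i → c (i, k) = 0) (l : ℕ) {i : σ} {k : ℕ} (h : B + l < k + o i) :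
    formDeriv^[l] c (i, k) = 0 := by
  induction l generalizing i k with
  | zero => exact hc i k h
  | succ l ih =>
    rw [Function.iterate_succ_apply']
    cases k with
    | zero => rw [formDeriv_apply_zero, ih (by omega), map_zero]
    | succ k => rw [formDeriv_apply_succ, ih (by omega), ih (by omega), map_zero, add_zero]

/-- The coefficients of `∂^l c` in the highest possible weight `B + l` are those of `c` in
weight `B`. -/
theorem iterate_formDeriv_apply_of_weight (o : σ → ℕ) {B : ℕ} (c : σ × ℕ →₀ R)
    (hc : ∀ i k, B < k + o i → c (i, k) = 0) (l : ℕ) {i : σ} {k : ℕ} (h : k + o i = B) :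
    formDeriv^[l] c (i, k + l) = c (i, k) := by
  induction l with
  | zero => rfl
  | succ l ih =>
    rw [Function.iterate_succ_apply', ← add_assoc, formDeriv_apply_succ, ih,
      iterate_formDeriv_eq_zero_of_weight o c hc l (by omega), map_zero, zero_add]

end formDeriv

/-! ### Linear relations among the derivatives of linear forms -/

/-- A linear combination may be computed along an injective family of indices that meets every
nonzero term. -/
theorem linearCombination_eq_sum_of_injective {R ι τ : Type*} [CommRing R] [Fintype ι] {f : ι → τ}
    (hf : Function.Injective f) (c : τ →₀ R) (y : τ → R)
    (hz : ∀ p, p ∉ Set.range f → c p * y p = 0) :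
    Finsupp.linearCombination R y c = ∑ r, c (f r) * y (f r) := by
  classical
  have hmap : ∑ r, c (f r) * y (f r) =
      ∑ p ∈ Finset.univ.map ⟨f, hf⟩, c p * y p := by
    rw [Finset.sum_map]
    rfl
  rw [Finsupp.linearCombination_apply, Finsupp.sum, hmap]
  refine Finset.sum_congr_of_eq_on_inter ?_ ?_ ?_
  · intro p _ hp
    exact hz p (by simpa using hp)
  · intro p _ hp
    rw [Finsupp.notMem_support_iff.1 hp, zero_mul]
  · intro p _ _
    rfl

/-- The left kernel of an injective `(m + 1) × m` matrix is one-dimensional. -/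
theorem exists_eq_smul_of_vecMul_eq_zero {K : Type*} [Field K] {m : ℕ}
    (S : Matrix (Fin (m + 1)) (Fin m) K) (hS : ∀ z, S.mulVec z = 0 → z = 0)
    {q₀ q : Fin (m + 1) → K} (hq₀ : q₀ ≠ 0) (h₀ : Matrix.vecMul q₀ S = 0)
    (h : Matrix.vecMul q S = 0) : ∃ a : K, q = a • q₀ := by
  have hrank : S.transpose.rank = m := by
    rw [Matrix.rank_transpose, Matrix.rank,
      LinearMap.finrank_range_of_inj (f := S.mulVecLin) ?_]
    · simp
    · rw [← LinearMap.ker_eq_bot, LinearMap.ker_eq_bot']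
      exact hS
  have hker : Module.finrank K (LinearMap.ker S.transpose.mulVecLin) = 1 := by
    have := LinearMap.finrank_range_add_finrank_ker S.transpose.mulVecLin
    rw [← Matrix.rank, hrank] at this
    simp only [Module.finrank_fintype_fun_eq_card, Fintype.card_fin] at this
    omega
  have hmem : ∀ {x}, Matrix.vecMul x S = 0 → x ∈ LinearMap.ker S.transpose.mulVecLin := by
    intro x hx
    rw [LinearMap.mem_ker, Matrix.mulVecLin_apply, Matrix.mulVec_transpose, hx]
  obtain ⟨a, ha⟩ := (finrank_eq_one_iff_of_nonzero'
    (⟨q₀, hmem h₀⟩ : LinearMap.ker S.transpose.mulVecLin)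
    (by simpa [Subtype.ext_iff] using hq₀)).1 hker ⟨q, hmem h⟩
  exact ⟨a, (congrArg Subtype.val ha).symm⟩

section relations

variable {K : Type*} [Field K] [Differential K] {σ ρ : Type*}

theorem formDeriv_smul (a : K) (c : σ × ℕ →₀ K) :
    formDeriv (a • c) = a′ • c + a • formDeriv c := by
  ext ⟨i, k⟩
  cases k with
  | zero =>
    simp only [formDeriv_apply_zero, Finsupp.add_apply, Finsupp.smul_apply, smul_eq_mul,
      Derivation.leibniz]
    ring
  | succ k =>
    simp only [formDeriv_apply_succ, Finsupp.add_apply, Finsupp.smul_apply, smul_eq_mul,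
      Derivation.leibniz]
    ring

/-- The substitution `x_{i,k} ↦ ∂^k h_i` on linear forms. Its kernel consists of the linear
relations among the derivatives of the forms `h_i`. -/
def substForm (h : ρ → σ × ℕ →₀ K) : (ρ × ℕ →₀ K) →ₗ[K] (σ × ℕ →₀ K) :=
  Finsupp.linearCombination K fun p => formDeriv^[p.2] (h p.1)

theorem substForm_apply (h : ρ → σ × ℕ →₀ K) (Q : ρ × ℕ →₀ K) (v : σ × ℕ) :
    substForm h Q v = Finsupp.linearCombination K (fun p => formDeriv^[p.2] (h p.1) v) Q := by
  simp [substForm, Finsupp.linearCombination_apply, Finsupp.sum, Finsupp.finsetSum_apply]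

theorem substForm_formDeriv (h : ρ → σ × ℕ →₀ K) (Q : ρ × ℕ →₀ K) :
    substForm h (formDeriv Q) = formDeriv (substForm h Q) := by
  induction Q using Finsupp.induction_linear with
  | zero => simp
  | add f g hf hg => simp [hf, hg]
  | single p a =>
    simp only [substForm, formDeriv_single, map_add, Finsupp.linearCombination_single,
      formDeriv_smul, Function.iterate_succ_apply']

theorem substForm_iterate_formDeriv (h : ρ → σ × ℕ →₀ K) {Q : ρ × ℕ →₀ K}
    (hQ : substForm h Q = 0) (l : ℕ) : substForm h (formDeriv^[l] Q) = 0 := by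
  induction l with
  | zero => exact hQ
  | succ l ih => rw [Function.iterate_succ_apply', substForm_formDeriv, ih, map_zero]

/-- The coefficients of `∂^k h_i` beyond `y_{j,k+o_i}` vanish. -/
theorem iterate_formDeriv_eq_zero_of_lt {h : σ × ℕ →₀ K} {o : ℕ}
    (ho : ∀ j k, o < k → h (j, k) = 0) {k t : ℕ} (hkt : k + o < t) (j : σ) :
    formDeriv^[k] h (j, t) = 0 :=
  iterate_formDeriv_eq_zero_of_weight (fun _ => 0) (B := o) h (by simpa using ho) k
    (by simpa [add_comm] using hkt)

/-- The coefficient of `∂^k h_i` at `y_{j,k+o_i}` is the one of `h_i` at `y_{j,o_i}`. -/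
theorem iterate_formDeriv_apply_add {h : σ × ℕ →₀ K} {o : ℕ}
    (ho : ∀ j k, o < k → h (j, k) = 0) {k t : ℕ} (hkt : k + o = t) (j : σ) :
    formDeriv^[k] h (j, t) = h (j, o) := by
  rw [← hkt, add_comm]
  exact iterate_formDeriv_apply_of_weight (fun _ => 0) (B := o) h (by simpa using ho) k (by simp)

/-- For a form in weights `k + o_i ≤ B`, the coefficient of its image at `y_{j,B}` only involves
the coefficients in weight `B` and the matrix of the leading coefficients of the `h_i`. -/
theorem substForm_apply_of_weight [Fintype ρ] {h : ρ → σ × ℕ →₀ K} {o : ρ → ℕ}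
    (ho : ∀ i j k, o i < k → h i (j, k) = 0) {B : ℕ} (hB : ∀ i, o i ≤ B) {Q : ρ × ℕ →₀ K}
    (hQ : ∀ i k, B < k + o i → Q (i, k) = 0) (j : σ) :
    substForm h Q (j, B) = ∑ i, Q (i, B - o i) * h i (j, o i) := by
  rw [substForm_apply, linearCombination_eq_sum_of_injective (f := fun i : ρ => (i, B - o i))]
  · refine Finset.sum_congr rfl fun i _ => ?_
    rw [iterate_formDeriv_apply_add (ho i) (Nat.sub_add_cancel (hB i))]
  · intro i i' h
    exact (Prod.ext_iff.1 h).1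
  · rintro ⟨i, k⟩ hp
    rcases lt_trichotomy (k + o i) B with hlt | heq | hgt
    · rw [iterate_formDeriv_eq_zero_of_lt (ho i) hlt, mul_zero]
    · exact (hp ⟨i, by simp [← heq]⟩).elim
    · rw [hQ i k hgt, zero_mul]

/-- Let the forms `∂^k h_i`, `k + o_i < N`, be linearly independent and let the matrix of leading
coefficients be injective. Then a nonzero relation `Q₀` of weight at most `N` generates all
relations: the highest coefficients of a relation lie in the one-dimensional left kernel of the
matrix of leading coefficients, so a multiple of a derivative of `Q₀` lowers its weight. -/
theorem exists_linearCombination_iterate_formDeriv {m N : ℕ}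
    {h : Fin (m + 1) → Fin m × ℕ →₀ K} {o : Fin (m + 1) → ℕ} (hoN : ∀ i, o i ≤ N)
    (ho : ∀ i j k, o i < k → h i (j, k) = 0)
    (hleft : ∀ Q : Fin (m + 1) × ℕ →₀ K, (∀ i k, N ≤ k + o i → Q (i, k) = 0) →
      substForm h Q = 0 → Q = 0)
    (hlead : ∀ z : Fin m → K, (∀ i, ∑ j, h i (j, o i) * z j = 0) → z = 0)
    {Q₀ : Fin (m + 1) × ℕ →₀ K} (hQ₀ : Q₀ ≠ 0) (hw₀ : ∀ i k, N < k + o i → Q₀ (i, k) = 0)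
    (hrel₀ : substForm h Q₀ = 0) {Q : Fin (m + 1) × ℕ →₀ K} (hrel : substForm h Q = 0) :
    ∃ d : ℕ →₀ K, Finsupp.linearCombination K (fun l => formDeriv^[l] Q₀) d = Q := by
  have htop₀ : (fun i => Q₀ (i, N - o i)) ≠ 0 := by
    intro h0
    refine hQ₀ (hleft Q₀ (fun i k hk => ?_) hrel₀)
    rcases hk.eq_or_lt with heq | hlt
    · have := congrFun h0 i
      rwa [show N - o i = k by omega] at this
    · exact hw₀ i k hlt
  have key : ∀ T : ℕ, ∀ Q : Fin (m + 1) × ℕ →₀ K, (∀ i k, N + T ≤ k + o i → Q (i, k) = 0) →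
      substForm h Q = 0 →
      ∃ d : ℕ →₀ K, Finsupp.linearCombination K (fun l => formDeriv^[l] Q₀) d = Q := by
    intro T
    induction T with
    | zero =>
      intro Q hw hQ
      exact ⟨0, by rw [map_zero, hleft Q hw hQ]⟩
    | succ T ih =>
      intro Q hw hQ
      have hw₁ : ∀ i k, N + T < k + o i → Q (i, k) = 0 := fun i k hk => hw i k (by omega)
      obtain ⟨a, ha⟩ := exists_eq_smul_of_vecMul_eq_zero (Matrix.of fun i j => h i (j, o i))
        (fun z hz => hlead z fun i => congrFun hz i) (q := fun i => Q (i, N + T - o i)) htop₀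
        (by
          ext j
          have := substForm_apply_of_weight ho hoN hw₀ j
          rw [hrel₀] at this
          exact this.symm)
        (by
          ext j
          have := substForm_apply_of_weight ho (fun i => (hoN i).trans (Nat.le_add_right N T)) hw₁ j
          rw [hQ] at this
          exact this.symm)
      obtain ⟨d, hd⟩ := ih (Q - a • formDeriv^[T] Q₀) (fun i k hk => by
          rw [Finsupp.sub_apply, Finsupp.smul_apply, smul_eq_mul]
          rcases hk.eq_or_lt with heq | hlt
          · have h1 := congrFun ha i
            have h2 := iterate_formDeriv_apply_of_weight o Q₀ hw₀ T (i := i) (k := N - o i)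
              (Nat.sub_add_cancel (hoN i))
            have := hoN i
            rw [show N - o i + T = k by omega] at h2
            simp only [Pi.smul_apply, smul_eq_mul] at h1
            rw [show N + T - o i = k by omega] at h1
            rw [h1, h2, sub_self]
          · rw [hw₁ i k hlt, iterate_formDeriv_eq_zero_of_weight o Q₀ hw₀ T hlt, mul_zero,
              sub_zero])
        (by rw [map_sub, map_smul, hQ, substForm_iterate_formDeriv h hrel₀, smul_zero, sub_zero])
      refine ⟨d + Finsupp.single T a, ?_⟩
      rw [map_add, hd, Finsupp.linearCombination_single, sub_add_cancel]
  refine key (Q.support.sup fun p => p.2 + o p.1 + 1) Q (fun i k hk => ?_) hrel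
  by_contra hne
  have : k + o i + 1 ≤ Q.support.sup fun p => p.2 + o p.1 + 1 :=
    Finset.le_sup (f := fun p : Fin (m + 1) × ℕ => p.2 + o p.1 + 1) (Finsupp.mem_support_iff.2 hne)
  omega

end relations

/-! ### Leads of derivatives of a linear form -/

section lead

variable {σ : Type*} (r : Ranking σ)

theorem Ranking.irrefl (v : σ × ℕ) : ¬ r.lt v v := r.isStrictTotalOrder.irrefl v

theorem Ranking.trans {u v w : σ × ℕ} : r.lt u v → r.lt v w → r.lt u w :=
  r.isStrictTotalOrder.trans u v w

theorem Ranking.trichotomous (v w : σ × ℕ) : r.lt v w ∨ v = w ∨ r.lt w v := by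
  have := r.isStrictTotalOrder
  exact trichotomous_of r.lt v w

theorem Ranking.lt_add (i : σ) (k : ℕ) {l : ℕ} (hl : 0 < l) : r.lt (i, k) (i, k + l) := by
  induction l, hl using Nat.le_induction with
  | base => exact r.lt_deriv i k
  | succ l _ ih => exact r.trans ih (r.lt_deriv i (k + l))

theorem Ranking.exists_max {s : Finset (σ × ℕ)} (hs : s.Nonempty) :
    ∃ v ∈ s, ∀ w ∈ s, w ≠ v → r.lt w v := by
  classical
  induction hs using Finset.Nonempty.cons_induction with
  | singleton a => exact ⟨a, by simp, by simp⟩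
  | cons a s ha hs ih =>
    obtain ⟨v, hv, hmax⟩ := ih
    rcases r.trichotomous a v with h | h | h
    · refine ⟨v, by simp [hv], fun w hw hne => ?_⟩
      rcases Finset.mem_cons.1 hw with rfl | hw
      · exact h
      · exact hmax w hw hne
    · exact (ha (h ▸ hv)).elim
    · refine ⟨a, by simp, fun w hw hne => ?_⟩
      rcases Finset.mem_cons.1 hw with rfl | hw
      · exact (hne rfl).elim
      · rcases eq_or_ne w v with rfl | hwv
        · exact h
        · exact r.trans (hmax w hw hwv) h

variable {K : Type*} [Field K] [Differential K]

theorem lt_of_formDeriv_ne_zero {c : σ × ℕ →₀ K} {v : σ × ℕ}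
    (hmax : ∀ w, c w ≠ 0 → w ≠ v → r.lt w v) {w : σ × ℕ} (hw : formDeriv c w ≠ 0)
    (hne : w ≠ (v.1, v.2 + 1)) : r.lt w (v.1, v.2 + 1) := by
  have hle : ∀ w, c w ≠ 0 → r.lt w (v.1, v.2 + 1) := by
    intro w hw
    rcases eq_or_ne w v with rfl | h
    · exact r.lt_deriv _ _
    · exact r.trans (hmax w hw h) (r.lt_deriv _ _)
  obtain ⟨i, k⟩ := w
  cases k with
  | zero =>
    refine hle _ fun h0 => hw ?_
    rw [formDeriv_apply_zero, h0, map_zero]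
  | succ k =>
    by_cases h1 : c (i, k + 1) = 0
    · have h2 : c (i, k) ≠ 0 := by
        intro h2
        apply hw
        rw [formDeriv_apply_succ, h1, h2, map_zero, add_zero]
      refine r.deriv_lt_deriv i k v.1 v.2 (hmax _ h2 ?_)
      rintro rfl
      exact hne rfl
    · exact hle _ h1

theorem lt_of_iterate_formDeriv_ne_zero {c : σ × ℕ →₀ K} {v : σ × ℕ}
    (hmax : ∀ w, c w ≠ 0 → w ≠ v → r.lt w v) (l : ℕ) {w : σ × ℕ} (hw : formDeriv^[l] c w ≠ 0)
    (hne : w ≠ (v.1, v.2 + l)) : r.lt w (v.1, v.2 + l) := by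
  induction l generalizing w with
  | zero => exact hmax w hw hne
  | succ l ih =>
    rw [Function.iterate_succ_apply'] at hw
    exact lt_of_formDeriv_ne_zero r (v := (v.1, v.2 + l)) (fun _ h h' => ih h h') hw hne

theorem iterate_formDeriv_apply_lead {c : σ × ℕ →₀ K} {v : σ × ℕ}
    (hmax : ∀ w, c w ≠ 0 → w ≠ v → r.lt w v) (l : ℕ) :
    formDeriv^[l] c (v.1, v.2 + l) = c v := by
  induction l with
  | zero => rfl
  | succ l ih =>
    have h0 : formDeriv^[l] c (v.1, v.2 + (l + 1)) = 0 := by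
      by_contra h0
      have h1 := lt_of_iterate_formDeriv_ne_zero r hmax l h0 (by simp)
      exact r.irrefl _ (r.trans h1 (r.lt_deriv _ _))
    rw [Function.iterate_succ_apply', ← add_assoc, formDeriv_apply_succ, ih, add_assoc, h0,
      map_zero, zero_add]

/-- A nonzero combination of the derivatives of a form with lead `v` involves a derivative
of `v`. -/
theorem exists_linearCombination_apply_ne_zero {c : σ × ℕ →₀ K} {v : σ × ℕ} (hv : c v ≠ 0)
    (hmax : ∀ w, c w ≠ 0 → w ≠ v → r.lt w v) {d : ℕ →₀ K} (hd : d ≠ 0) :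
    ∃ s, Finsupp.linearCombination K (fun l => formDeriv^[l] c) d (v.1, v.2 + s) ≠ 0 := by
  classical
  have hne : d.support.Nonempty := Finsupp.support_nonempty_iff.2 hd
  set s := d.support.max' hne
  have hs : d s ≠ 0 := Finsupp.mem_support_iff.1 (d.support.max'_mem hne)
  refine ⟨s, ?_⟩
  rw [Finsupp.linearCombination_apply, Finsupp.sum, Finsupp.finsetSum_apply,
    Finset.sum_eq_single s]
  · rw [Finsupp.smul_apply, iterate_formDeriv_apply_lead r hmax]
    exact mul_ne_zero hs hv
  · intro l hl hls
    have hlt : l < s := lt_of_le_of_ne (d.support.le_max' l hl) hls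
    rw [Finsupp.smul_apply]
    refine mul_eq_zero_of_right _ ?_
    by_contra h0
    have h1 := lt_of_iterate_formDeriv_ne_zero r hmax l h0 (by simp; omega)
    have h2 := r.lt_add v.1 (v.2 + l) (l := s - l) (by omega)
    rw [show v.2 + l + (s - l) = v.2 + s by omega] at h2
    exact r.irrefl _ (r.trans h1 h2)
  · intro h
    exact (h (d.support.max'_mem hne)).elim

end lead

/-! ### Determinants with one column of indeterminates -/

section matrix

variable {K : Type*} [Field K] {ι : Type*} [Fintype ι] [DecidableEq ι]

theorem updateCol_mulVec_of_col_eq_zero (A : Matrix ι ι K) {l : ι} (hA : ∀ i, A i l = 0)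
    (t y : ι → K) : (A.updateCol l t).mulVec y = A.mulVec y + y l • t := by
  ext i
  have h : ∀ j, A.updateCol l t i j * y j = A i j * y j + if j = l then y l * t i else 0 := by
    intro j
    rw [Matrix.updateCol_apply]
    split_ifs with hj
    · rw [hj, hA, zero_mul, zero_add, mul_comm]
    · rw [add_zero]
  simp [Matrix.mulVec, dotProduct, h, Finset.sum_add_distrib]

theorem det_map_updateCol {S : Type*} [CommRing S] (φ : K →+* S) (A : Matrix ι ι K) (l : ι)
    (b : ι → S) :
    ((A.map φ).updateCol l b).det = ∑ i, φ (A.adjugate l i) * b i := by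
  rw [← Matrix.cramer_apply, Matrix.cramer_eq_adjugate_mulVec, ← RingHom.mapMatrix_apply,
    ← RingHom.map_adjugate]
  rfl

/-- The minors complementary to a zero column are not all zero if and only if the remaining
columns are linearly independent. -/
theorem exists_adjugate_ne_zero_iff (A : Matrix ι ι K) {l : ι} (hA : ∀ i, A i l = 0) :
    (∃ i, A.adjugate l i ≠ 0) ↔ ∀ y : ι → K, y l = 0 → A.mulVec y = 0 → y = 0 := by
  have hdet : ∀ t : ι → K, (A.updateCol l t).det = ∑ i, A.adjugate l i * t i := fun t => by
    rw [← Matrix.cramer_apply, Matrix.cramer_eq_adjugate_mulVec]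
    rfl
  constructor
  · rintro ⟨i, hi⟩ y hy hAy
    refine Matrix.eq_zero_of_mulVec_eq_zero (M := A.updateCol l (Pi.single i 1)) ?_ ?_
    · rw [hdet]
      simpa [Pi.single_apply] using hi
    · rw [updateCol_mulVec_of_col_eq_zero A hA, hy, hAy, zero_smul, add_zero]
  · intro hinj
    by_contra! h0
    -- a vector outside the column space completes `A` to a regular matrix
    have hsurj : ¬ Function.Surjective A.mulVec := by
      rw [Matrix.mulVec_surjective_iff_isUnit, Matrix.isUnit_iff_isUnit_det,
        Matrix.det_eq_zero_of_column_eq_zero l hA]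
      exact not_isUnit_zero
    obtain ⟨t, ht⟩ := not_forall.1 hsurj
    have hz : (A.updateCol l t).det = 0 := by simp [hdet, h0]
    obtain ⟨y, hy, hBy⟩ := Matrix.exists_mulVec_eq_zero_iff.2 hz
    rw [updateCol_mulVec_of_col_eq_zero A hA] at hBy
    by_cases hyl : y l = 0
    · rw [hyl, zero_smul, add_zero] at hBy
      exact hy (hinj y hyl hBy)
    · refine ht ⟨-(y l)⁻¹ • y, ?_⟩
      rw [Matrix.mulVec_smul, eq_neg_of_add_eq_zero_left hBy, smul_neg, neg_smul, neg_neg,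
        smul_smul, inv_mul_cancel₀ hyl, one_smul]

end matrix

/-! ### The rows and columns of the resultant matrices -/

section indices

theorem finSigma_rev_injective {M n : ℕ} {c : Fin n → ℕ} (e : Fin M ≃ (i : Fin n) × Fin (c i)) :
    Function.Injective fun k => ((e k).1, ((e k).2.rev : ℕ)) := by
  have key : ∀ p p' : (i : Fin n) × Fin (c i), p.1 = p'.1 → (p.2.rev : ℕ) = p'.2.rev → p = p' := by
    rintro ⟨i, x⟩ ⟨i', x'⟩ h h'
    obtain rfl : i = i' := h
    exact congrArg (Sigma.mk i) (Fin.rev_injective (Fin.ext h'))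
  intro k k' h
  obtain ⟨h1, h2⟩ := Prod.mk.inj h
  exact e.injective (key _ _ h1 h2)

theorem mem_range_finSigma_rev {M n : ℕ} {c : Fin n → ℕ} (e : Fin M ≃ (i : Fin n) × Fin (c i))
    (i : Fin n) (k : ℕ) :
    (i, k) ∈ Set.range (fun k => ((e k).1, ((e k).2.rev : ℕ))) ↔ k < c i := by
  constructor
  · rintro ⟨x, hx⟩
    obtain ⟨rfl, rfl⟩ := Prod.mk.inj hx
    exact (e x).2.rev.is_lt
  · intro hk
    refine ⟨e.symm ⟨i, Fin.rev ⟨k, hk⟩⟩, ?_⟩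
    refine (congrArg (fun p : (i : Fin n) × Fin (c i) => (p.1, (p.2.rev : ℕ)))
      (e.apply_symm_apply _)).trans ?_
    simp only [Fin.rev_rev]

theorem orderlyVar_injective (m M : ℕ) : Function.Injective (orderlyVar m M) := by
  intro c c' h
  apply finProdFinEquiv.symm.injective
  obtain ⟨h1, h2⟩ := Prod.mk.inj h
  exact Prod.ext (Fin.rev_injective (Fin.ext h2)) (Fin.rev_injective h1)

theorem mem_range_orderlyVar {m M : ℕ} (v : Fin m × ℕ) :
    v ∈ Set.range (orderlyVar m M) ↔ v.2 < M := by
  constructor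
  · rintro ⟨c, rfl⟩
    exact (finProdFinEquiv.symm c).1.rev.is_lt
  · intro h
    refine ⟨finProdFinEquiv (Fin.rev ⟨v.2, h⟩, v.1.rev), ?_⟩
    simp [orderlyVar]

variable {m : ℕ} {R : Type*} [CommRing R] (f : Fin (m + 1) → DiffPoly R (Fin m))

/-- The row `k` of the differential resultant matrix belongs to `∂^l f_i`, where
`(i, l) = resIndex f k`. -/
def resIndex (k : Fin ((totalOrder f + 1) * m + 1)) : Fin (m + 1) × ℕ :=
  let p : (i : Fin (m + 1)) × Fin (totalOrder f - order (f i) + 1) :=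
    finSigmaFinEquiv.symm (finCongr (sum_totalOrder_sub_add_one f).symm k)
  (p.1, (p.2.rev : ℕ))

/-- The row `k` of the differential homogeneous resultant matrix belongs to `∂^l f_i`, where
`(i, l) = homResIndex f k`. -/
def homResIndex (k : Fin (totalOrder f * m)) : Fin (m + 1) × ℕ :=
  let p : (i : Fin (m + 1)) × Fin (totalOrder f - order (f i)) :=
    finSigmaFinEquiv.symm (finCongr (sum_totalOrder_sub f).symm k)
  (p.1, (p.2.rev : ℕ))

theorem resIndex_injective : Function.Injective (resIndex f) :=
  finSigma_rev_injective
    ((finCongr (sum_totalOrder_sub_add_one f).symm).trans finSigmaFinEquiv.symm)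

theorem homResIndex_injective : Function.Injective (homResIndex f) :=
  finSigma_rev_injective ((finCongr (sum_totalOrder_sub f).symm).trans finSigmaFinEquiv.symm)

theorem mem_range_resIndex (i : Fin (m + 1)) (k : ℕ) :
    (i, k) ∈ Set.range (resIndex f) ↔ k + order (f i) ≤ totalOrder f := by
  refine (mem_range_finSigma_rev
    ((finCongr (sum_totalOrder_sub_add_one f).symm).trans finSigmaFinEquiv.symm) i k).trans ?_
  have := order_le_totalOrder f i
  omega

theorem mem_range_homResIndex (i : Fin (m + 1)) (k : ℕ) :
    (i, k) ∈ Set.range (homResIndex f) ↔ k + order (f i) < totalOrder f := by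
  refine (mem_range_finSigma_rev
    ((finCongr (sum_totalOrder_sub f).symm).trans finSigmaFinEquiv.symm) i k).trans ?_
  have := order_le_totalOrder f i
  omega

end indices

/-! ### Affine systems -/

section affine

variable {K : Type*} [Field K] {m : ℕ} (a : Fin (m + 1) → K) (h : Fin (m + 1) → Fin m × ℕ →₀ K)

/-- The system `P_i = a_i - ∑ h_{i,v} u_v`. -/
def affineSystem (i : Fin (m + 1)) : DiffPoly K (Fin m) :=
  MvPolynomial.C (a i) - linForm (h i)

/-- The order of the linear form with coefficient vector `c`. -/
def formOrder {R σ : Type*} [CommRing R] (c : σ × ℕ →₀ R) : ℕ := c.support.sup Prod.snd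

theorem apply_eq_zero_of_formOrder_lt {R σ : Type*} [CommRing R] {c : σ × ℕ →₀ R} (j : σ) (k : ℕ)
    (hk : formOrder c < k) : c (j, k) = 0 := by
  by_contra hne
  have : k ≤ formOrder c :=
    Finset.le_sup (f := Prod.snd) (Finsupp.mem_support_iff.2 hne : (j, k) ∈ c.support)
  omega

theorem order_C_add_linForm {R σ : Type*} [CommRing R] (b : R) (c : σ × ℕ →₀ R) :
    order (MvPolynomial.C b + linForm c) = formOrder c := by
  rw [order, vars_C_add_linForm, formOrder]

theorem homPart_affineSystem (i : Fin (m + 1)) :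
    homPart (affineSystem a h) i = MvPolynomial.C 0 + linForm (h i) := by
  rw [homPart, affineSystem, MvPolynomial.coeff_sub, coeff_zero_linForm, MvPolynomial.coeff_C,
    if_pos rfl]
  simp

theorem implicitForm_affineSystem (i : Fin (m + 1)) :
    implicitForm (affineSystem a h) i =
      MvPolynomial.C (MvPolynomial.X (i, 0) - MvPolynomial.C (a i)) +
        linForm ((h i).mapRange (MvPolynomial.C : K →+* DiffPoly K (Fin (m + 1)))
          (map_zero _)) := by
  rw [implicitForm, affineSystem, map_sub, MvPolynomial.map_C, map_linForm, map_sub]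
  ring

theorem order_homPart_affineSystem (i : Fin (m + 1)) :
    order (homPart (affineSystem a h) i) = formOrder (h i) := by
  rw [homPart_affineSystem, order_C_add_linForm]

theorem order_implicitForm_affineSystem (i : Fin (m + 1)) :
    order (implicitForm (affineSystem a h) i) = formOrder (h i) := by
  rw [implicitForm_affineSystem, order_C_add_linForm, formOrder,
    Finsupp.support_mapRange_of_injective _ _ (MvPolynomial.C_injective _ _), formOrder]

theorem totalOrder_homPart_affineSystem :
    totalOrder (homPart (affineSystem a h)) = ∑ i, formOrder (h i) :=
  Finset.sum_congr rfl fun i _ => order_homPart_affineSystem a h i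

theorem totalOrder_implicitForm_affineSystem :
    totalOrder (implicitForm (affineSystem a h)) = ∑ i, formOrder (h i) :=
  Finset.sum_congr rfl fun i _ => order_implicitForm_affineSystem a h i

variable [Differential K]

theorem iterate_deriv_affineSystem (i : Fin (m + 1)) (k : ℕ) :
    (Differential.deriv : DiffPoly K (Fin m) → DiffPoly K (Fin m))^[k] (affineSystem a h i) =
      MvPolynomial.C ((Differential.deriv : K → K)^[k] (a i)) - linForm (formDeriv^[k] (h i)) := by
  have hneg : formDeriv^[k] (-h i) = -formDeriv^[k] (h i) := by
    induction k with
    | zero => rfl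
    | succ k ih => rw [Function.iterate_succ_apply', ih, map_neg, Function.iterate_succ_apply']
  rw [affineSystem, sub_eq_add_neg, ← map_neg, iterate_deriv_C_add_linForm, hneg, map_neg,
    sub_eq_add_neg]

theorem homResMatrix_affineSystem_apply (r c) :
    homResMatrix (homPart (affineSystem a h)) r c =
      formDeriv^[(homResIndex (homPart (affineSystem a h)) r).2]
        (h (homResIndex (homPart (affineSystem a h)) r).1) (orderlyVar m _ c) := by
  change MvPolynomial.coeff _ ((Differential.deriv : DiffPoly K (Fin m) → DiffPoly K (Fin m))^[
    (homResIndex (homPart (affineSystem a h)) r).2]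
      (homPart (affineSystem a h) (homResIndex (homPart (affineSystem a h)) r).1)) = _
  rw [homPart_affineSystem, iterate_deriv_C_add_linForm, MvPolynomial.coeff_add,
    coeff_single_linForm, MvPolynomial.coeff_C, if_neg (by simp [eq_comm]), zero_add]

theorem iterate_deriv_X_sub_C (i : Fin (m + 1)) (b : K) (k : ℕ) :
    (Differential.deriv : DiffPoly K (Fin (m + 1)) → DiffPoly K (Fin (m + 1)))^[k]
        (MvPolynomial.X (i, 0) - MvPolynomial.C b) =
      MvPolynomial.X (i, k) - MvPolynomial.C ((Differential.deriv : K → K)^[k] b) := by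
  induction k with
  | zero => rfl
  | succ k ih =>
    rw [Function.iterate_succ_apply', ih, map_sub, deriv_X, deriv_C, Function.iterate_succ_apply']

/-- The coefficient matrix of the forms `∂^k h_i`, `k + o_i ≤ N`, with an additional zero column
at the place of the constant terms. -/
def formMatrix : Matrix (Fin ((totalOrder (implicitForm (affineSystem a h)) + 1) * m + 1))
    (Fin ((totalOrder (implicitForm (affineSystem a h)) + 1) * m + 1)) K :=
  Matrix.of fun r c =>
    Sum.elim
      (fun c' => formDeriv^[(resIndex (implicitForm (affineSystem a h)) r).2]
        (h (resIndex (implicitForm (affineSystem a h)) r).1) (orderlyVar m _ c'))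
      (fun _ => 0)
      (finSumFinEquiv.symm c :
        Fin ((totalOrder (implicitForm (affineSystem a h)) + 1) * m) ⊕ Fin 1)

theorem formMatrix_apply_inl (r c) :
    formMatrix a h r (finSumFinEquiv (Sum.inl c)) =
      formDeriv^[(resIndex (implicitForm (affineSystem a h)) r).2]
        (h (resIndex (implicitForm (affineSystem a h)) r).1) (orderlyVar m _ c) := by
  simp only [formMatrix, Matrix.of_apply, Equiv.symm_apply_apply, Sum.elim_inl]

theorem formMatrix_apply_inr (r) : formMatrix a h r (finSumFinEquiv (Sum.inr 0)) = 0 := by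
  simp only [formMatrix, Matrix.of_apply, Equiv.symm_apply_apply, Sum.elim_inr]

theorem resMatrix_affineSystem :
    resMatrix (implicitForm (affineSystem a h)) =
      ((formMatrix a h).map (MvPolynomial.C : K →+* DiffPoly K (Fin (m + 1)))).updateCol
        (finSumFinEquiv (Sum.inr 0)) fun r =>
          MvPolynomial.X (resIndex (implicitForm (affineSystem a h)) r) -
            MvPolynomial.C ((Differential.deriv : K → K)^[
              (resIndex (implicitForm (affineSystem a h)) r).2]
                (a (resIndex (implicitForm (affineSystem a h)) r).1)) := by
  have hrow : ∀ r, resRow (implicitForm (affineSystem a h)) r =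
      MvPolynomial.C (MvPolynomial.X (resIndex (implicitForm (affineSystem a h)) r) -
        MvPolynomial.C ((Differential.deriv : K → K)^[
          (resIndex (implicitForm (affineSystem a h)) r).2]
            (a (resIndex (implicitForm (affineSystem a h)) r).1))) +
      linForm ((formDeriv^[(resIndex (implicitForm (affineSystem a h)) r).2]
        (h (resIndex (implicitForm (affineSystem a h)) r).1)).mapRange
          (MvPolynomial.C : K →+* DiffPoly K (Fin (m + 1))) (map_zero _)) := by
    intro r
    change (Differential.deriv : DiffPoly (DiffPoly K (Fin (m + 1))) (Fin m) →
      DiffPoly (DiffPoly K (Fin (m + 1))) (Fin m))^[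
        (resIndex (implicitForm (affineSystem a h)) r).2]
          (implicitForm (affineSystem a h) (resIndex (implicitForm (affineSystem a h)) r).1) = _
    rw [implicitForm_affineSystem, iterate_deriv_C_add_linForm, iterate_deriv_X_sub_C,
      iterate_formDeriv_mapRange _ fun b => deriv_C b]
  ext1 r c
  obtain ⟨c, rfl⟩ := finSumFinEquiv.surjective c
  rw [Matrix.updateCol_apply, resMatrix, Matrix.of_apply, Equiv.symm_apply_apply, hrow]
  rcases c with c | c
  · rw [if_neg (finSumFinEquiv.injective.ne (by simp)), Matrix.map_apply, formMatrix_apply_inl, Sum.elim_inl,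
      MvPolynomial.coeff_add, coeff_single_linForm, MvPolynomial.coeff_C,
      if_neg (by simp [eq_comm]), zero_add, Finsupp.mapRange_apply]
  · rw [Subsingleton.elim c 0, if_pos rfl, Sum.elim_inr, MvPolynomial.coeff_add,
      coeff_zero_linForm, MvPolynomial.coeff_C, if_pos rfl, add_zero]

/-- The differential resultant, expanded along its last column: it is an affine form whose linear
part `Q₀` is a relation among the `∂^k h_i`, `k + o_i ≤ N`, and it does not vanish if these forms
span the forms of order at most `N`. -/
theorem diffRes_affineSystem :
    ∃ Q₀ : Fin (m + 1) × ℕ →₀ K,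
      (∀ i k, ∑ i, formOrder (h i) < k + formOrder (h i) → Q₀ (i, k) = 0) ∧
      substForm h Q₀ = 0 ∧
      diffRes (implicitForm (affineSystem a h)) =
        linForm Q₀ - MvPolynomial.C (Finsupp.linearCombination K
          (fun p => (Differential.deriv : K → K)^[p.2] (a p.1)) Q₀) ∧
      (Q₀ ≠ 0 ↔ ∀ y : Fin m × ℕ → K,
        (∀ i k, k + formOrder (h i) ≤ ∑ i, formOrder (h i) →
          Finsupp.linearCombination K y (formDeriv^[k] (h i)) = 0) →
        ∀ v, v.2 ≤ ∑ i, formOrder (h i) → y v = 0) := by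
  have hN := totalOrder_implicitForm_affineSystem a h
  have ho := order_implicitForm_affineSystem a h
  set F := implicitForm (affineSystem a h)
  have hinj := resIndex_injective F
  set last : Fin ((totalOrder F + 1) * m + 1) := finSumFinEquiv (Sum.inr 0)
  set A := formMatrix a h
  have hA0 : ∀ r, A r last = 0 := formMatrix_apply_inr a h
  set Q₀ : Fin (m + 1) × ℕ →₀ K := ∑ r, Finsupp.single (resIndex F r) (A.adjugate last r)
  have hQr : ∀ r, Q₀ (resIndex F r) = A.adjugate last r := by
    intro r
    simp only [Q₀, Finsupp.finsetSum_apply]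
    rw [Finset.sum_eq_single r]
    · simp
    · intro s _ hs
      exact Finsupp.single_eq_of_ne fun he => hs (hinj he).symm
    · simp
  have hQ0 : ∀ i k, ∑ i, formOrder (h i) < k + formOrder (h i) → Q₀ (i, k) = 0 := by
    intro i k hk
    simp only [Q₀, Finsupp.finsetSum_apply]
    refine Finset.sum_eq_zero fun r _ => Finsupp.single_eq_of_ne fun he => ?_
    have := (mem_range_resIndex F i k).1 ⟨r, he.symm⟩
    rw [ho, hN] at this
    omega
  -- the forms `∂^k h_i` have no coefficients outside the columns of `A`
  have hcol : ∀ i k, k + formOrder (h i) ≤ ∑ i, formOrder (h i) → ∀ v : Fin m × ℕ,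
      v ∉ Set.range (orderlyVar m (totalOrder F + 1)) → formDeriv^[k] (h i) v = 0 := by
    rintro i k hk ⟨j, t⟩ hv
    rw [mem_range_orderlyVar, hN] at hv
    exact iterate_formDeriv_eq_zero_of_lt apply_eq_zero_of_formOrder_lt (by simp at hv; omega) j
  have hrange : ∀ r, (resIndex F r).2 + formOrder (h (resIndex F r).1) ≤
      ∑ i, formOrder (h i) := by
    intro r
    have := (mem_range_resIndex F (resIndex F r).1 (resIndex F r).2).1 ⟨r, rfl⟩
    rwa [ho, hN] at this
  have hmul : ∀ (y : Fin m × ℕ → K) (z : Fin ((totalOrder F + 1) * m + 1) → K), z last = 0 →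
      (∀ c, z (finSumFinEquiv (Sum.inl c)) = y (orderlyVar m _ c)) → ∀ r, A.mulVec z r =
        Finsupp.linearCombination K y (formDeriv^[(resIndex F r).2] (h (resIndex F r).1)) := by
    intro y z hz hzy r
    rw [linearCombination_eq_sum_of_injective (orderlyVar_injective m (totalOrder F + 1)) _ _
      fun v hv => by rw [hcol _ _ (hrange r) v hv, zero_mul]]
    rw [Matrix.mulVec, dotProduct, ← finSumFinEquiv.sum_comp, Fintype.sum_sum_type]
    simp only [Finset.univ_unique, Finset.sum_singleton, Fin.default_eq_zero]
    rw [hz, mul_zero, add_zero]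
    refine Finset.sum_congr rfl fun c _ => ?_
    rw [hzy, ← formMatrix_apply_inl a h]
  have hne : Q₀ ≠ 0 ↔ ∃ r, A.adjugate last r ≠ 0 := by
    constructor
    · intro hQ
      by_contra! h0
      exact hQ (by simp [Q₀, h0])
    · rintro ⟨r, hr⟩ h0
      rw [← hQr, h0] at hr
      exact hr rfl
  refine ⟨Q₀, hQ0, ?_, ?_, ?_⟩
  · have hdet : A.det = 0 := Matrix.det_eq_zero_of_column_eq_zero last hA0
    ext v
    rw [substForm_apply, Finsupp.zero_apply]
    simp only [Q₀, map_sum, Finsupp.linearCombination_single, smul_eq_mul]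
    by_cases hv : v ∈ Set.range (orderlyVar m (totalOrder F + 1))
    · obtain ⟨c, rfl⟩ := hv
      have := congrFun (congrFun (Matrix.adjugate_mul A) last) (finSumFinEquiv (Sum.inl c))
      rw [hdet, zero_smul, Matrix.mul_apply] at this
      rw [← Matrix.zero_apply, ← this]
      exact Finset.sum_congr rfl fun r _ => by rw [← formMatrix_apply_inl a h]
    · exact Finset.sum_eq_zero fun r _ => by rw [hcol _ _ (hrange r) v hv, mul_zero]
  · rw [diffRes, resMatrix_affineSystem, det_map_updateCol]
    simp only [Q₀, map_sum, linForm_single, Finsupp.linearCombination_single, smul_eq_mul,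
      map_mul, mul_sub, Finset.sum_sub_distrib]
    rfl
  · rw [hne, exists_adjugate_ne_zero_iff A hA0]
    constructor
    · intro H y hy v hv
      have hz := H (fun c => Sum.elim (fun c' => y (orderlyVar m _ c')) (fun _ => 0)
        (finSumFinEquiv.symm c : Fin ((totalOrder F + 1) * m) ⊕ Fin 1))
        (by simp only [last, Equiv.symm_apply_apply, Sum.elim_inr]) (by
          ext r
          rw [hmul y _ (by simp only [last, Equiv.symm_apply_apply, Sum.elim_inr])
            (fun c => by simp only [Equiv.symm_apply_apply, Sum.elim_inl])]
          exact hy _ _ (hrange r))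
      obtain ⟨c, rfl⟩ := (mem_range_orderlyVar (M := totalOrder F + 1) v).2 (by omega)
      have := congrFun hz (finSumFinEquiv (Sum.inl c))
      simpa only [Equiv.symm_apply_apply, Sum.elim_inl, Pi.zero_apply] using this
    · intro H z hz hAz
      set y : Fin m × ℕ → K := Function.extend (orderlyVar m (totalOrder F + 1))
        (fun c => z (finSumFinEquiv (Sum.inl c))) 0
      have hzy : ∀ c, z (finSumFinEquiv (Sum.inl c)) = y (orderlyVar m _ c) := fun c =>
        ((orderlyVar_injective m (totalOrder F + 1)).extend_apply
          (fun c => z (finSumFinEquiv (Sum.inl c))) 0 c).symm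
      have hy := H y fun i k hk => by
        obtain ⟨r, hr⟩ := (mem_range_resIndex F i k).2 (by rwa [ho, hN])
        have := hmul y z hz hzy r
        rwa [hAz, hr, Pi.zero_apply, eq_comm] at this
      ext c
      obtain ⟨c, rfl⟩ := finSumFinEquiv.surjective c
      rcases c with c | c
      · rw [hzy, Pi.zero_apply]
        exact hy _ (by
          rw [← hN]
          exact Nat.lt_succ_iff.1 ((mem_range_orderlyVar (M := totalOrder F + 1) _).1 ⟨c, rfl⟩))
      · rw [Subsingleton.elim c 0]
        exact hz

/-- If the differential homogeneous resultant does not vanish, the forms `∂^k h_i`, `k + o_i < N`,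
span the forms of order less than `N`. -/
theorem eq_zero_of_homDiffRes_ne_zero (hres : homDiffRes (homPart (affineSystem a h)) ≠ 0)
    {y : Fin m × ℕ → K}
    (hy : ∀ i k, k + formOrder (h i) < ∑ i, formOrder (h i) →
      Finsupp.linearCombination K y (formDeriv^[k] (h i)) = 0)
    (v : Fin m × ℕ) (hv : v.2 < ∑ i, formOrder (h i)) : y v = 0 := by
  have hN := totalOrder_homPart_affineSystem a h
  have ho := order_homPart_affineSystem a h
  have hz := Matrix.eq_zero_of_mulVec_eq_zero hres
    (v := fun c => y (orderlyVar m _ c)) (by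
      ext r
      have hr := (mem_range_homResIndex (homPart (affineSystem a h)) (homResIndex _ r).1
        (homResIndex _ r).2).1 ⟨r, rfl⟩
      rw [ho, hN] at hr
      rw [Pi.zero_apply, ← hy _ _ hr, linearCombination_eq_sum_of_injective
        (orderlyVar_injective m (totalOrder (homPart (affineSystem a h))))]
      · rw [Matrix.mulVec, dotProduct]
        exact Finset.sum_congr rfl fun c _ => by rw [homResMatrix_affineSystem_apply]
      · rintro ⟨j, t⟩ hp
        rw [mem_range_orderlyVar, hN] at hp
        rw [iterate_formDeriv_eq_zero_of_lt apply_eq_zero_of_formOrder_lt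
          (by simp at hp; omega) j, zero_mul])
  obtain ⟨c, rfl⟩ := (mem_range_orderlyVar v).2 (hN.symm ▸ hv)
  exact congrFun hz c

/-- If the differential homogeneous resultant does not vanish, the forms `∂^k h_i`, `k + o_i < N`,
are linearly independent. -/
theorem eq_zero_of_substForm_eq_zero (hres : homDiffRes (homPart (affineSystem a h)) ≠ 0)
    {Q : Fin (m + 1) × ℕ →₀ K}
    (hQ : ∀ i k, ∑ i, formOrder (h i) ≤ k + formOrder (h i) → Q (i, k) = 0)
    (hrel : substForm h Q = 0) : Q = 0 := by
  have hN := totalOrder_homPart_affineSystem a h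
  have ho := order_homPart_affineSystem a h
  have hsupp : ∀ p, p ∉ Set.range (homResIndex (homPart (affineSystem a h))) → Q p = 0 := by
    rintro ⟨i, k⟩ hp
    rw [mem_range_homResIndex, ho, hN] at hp
    exact hQ i k (by omega)
  have hz := Matrix.eq_zero_of_vecMul_eq_zero hres
    (v := fun r => Q (homResIndex _ r)) (by
      ext c
      have hc := DFunLike.congr_fun hrel (orderlyVar m _ c)
      rw [substForm_apply, linearCombination_eq_sum_of_injective
        (homResIndex_injective (homPart (affineSystem a h))) _ _
        fun p hp => by rw [hsupp p hp, zero_mul]] at hc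
      rw [Pi.zero_apply, ← Finsupp.zero_apply, ← hc]
      rw [Matrix.vecMul, dotProduct]
      exact Finset.sum_congr rfl fun r _ => by rw [homResMatrix_affineSystem_apply])
  ext p
  by_cases hp : p ∈ Set.range (homResIndex (homPart (affineSystem a h)))
  · obtain ⟨r, rfl⟩ := hp
    exact congrFun hz r
  · exact hsupp p hp

end affine

/-! ### Characteristic sets consisting of one polynomial -/

section charSet

variable {K : Type*} [Field K] {σ : Type*} {r : Ranking σ}

theorem IsLead.unique {f : DiffPoly K σ} {v w : σ × ℕ} (hv : IsLead r f v) (hw : IsLead r f w) :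
    v = w := by
  by_contra hne
  exact r.irrefl _ (r.trans (hv.2 w hw.1 (Ne.symm hne)) (hw.2 v hv.1 hne))

theorem IsLead.degreeOf_pos {f : DiffPoly K σ} {v : σ × ℕ} (hv : IsLead r f v) :
    0 < MvPolynomial.degreeOf v f :=
  Nat.pos_of_ne_zero (MvPolynomial.mem_vars_iff_degreeOf_ne_zero.1 hv.1)

variable {I : Ideal (DiffPoly K σ)} {D : DiffPoly K σ} {v : σ × ℕ}

theorem not_lt_of_mem_vars {f : DiffPoly K σ} {w : σ × ℕ} {s : ℕ} (hw : IsLead r f w)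
    (hs : (v.1, v.2 + s) ∈ f.vars) : ¬ r.lt w v := by
  intro hlt
  have h1 : r.lt (v.1, v.2 + s) v := by
    by_cases he : (v.1, v.2 + s) = w
    · rwa [he]
    · exact r.trans (hw.2 _ hs he) hlt
  rcases Nat.eq_zero_or_pos s with rfl | hpos
  · exact r.irrefl _ h1
  · exact r.irrefl _ (r.trans h1 (r.lt_add v.1 v.2 hpos))

theorem not_rankLT_of_isLead (hlead : IsLead r D v) (hdeg : MvPolynomial.degreeOf v D = 1)
    {f : DiffPoly K σ} (hf : ∃ s, (v.1, v.2 + s) ∈ f.vars) : ¬ RankLT r f D := by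
  rintro ⟨w, v', hw, hv', h⟩
  obtain rfl := hv'.unique hlead
  obtain ⟨s, hs⟩ := hf
  rcases h with hlt | ⟨rfl, hlt⟩
  · exact not_lt_of_mem_vars hw hs hlt
  · have := hw.degreeOf_pos
    omega

/-- If `D ∈ I` has degree one in its lead `v`, and every element of `I` outside `K` involves `v` or
a derivative of `v`, then `D` forms a characteristic set of `I`. -/
theorem isCharSet_singleton (hD : D ∈ I) (hlead : IsLead r D v)
    (hdeg : MvPolynomial.degreeOf v D = 1)
    (hI : ∀ f ∈ I, f.vars.Nonempty → ∃ s, (v.1, v.2 + s) ∈ f.vars) : IsCharSet r I [D] := by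
  refine ⟨⟨⟨fun f hf => ⟨v, by rwa [List.mem_singleton.1 hf]⟩, List.pairwise_singleton _ _⟩, by simpa using hD⟩, ?_⟩
  rintro (_ | ⟨f, B⟩) hB hBI h
  · exact h
  obtain ⟨w, hw⟩ := hB.1 f (by simp)
  rcases h with h | ⟨⟨u, hfu, hDu, hu⟩, h⟩
  · exact not_rankLT_of_isLead hlead hdeg (hI f (hBI f (by simp)) ⟨w, hw.1⟩) h
  obtain rfl := hDu.unique hlead
  rcases B with _ | ⟨g, B⟩
  · exact h
  -- a polynomial reduced with respect to `f` involves no derivative of the lead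
  obtain ⟨x, hx⟩ := hB.1 g (by simp)
  obtain ⟨s, hs⟩ := hI g (hBI g (by simp)) ⟨x, hx.1⟩
  obtain ⟨u', hu', hder, hlt⟩ := ((List.pairwise_cons.1 hB.2).1 g (by simp)).2
  obtain rfl := hu'.unique hfu
  rcases Nat.eq_zero_or_pos s with rfl | hpos
  · have := MvPolynomial.mem_vars_iff_degreeOf_ne_zero.1 hs
    rw [add_zero] at this
    change MvPolynomial.degreeOf u' g ≠ 0 at this
    omega
  · exact hder _ (by omega) hs

theorem length_eq_one_of_isCharSet (hD : D ∈ I) (hlead : IsLead r D v)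
    (hdeg : MvPolynomial.degreeOf v D = 1)
    (hI : ∀ f ∈ I, f.vars.Nonempty → ∃ s, (v.1, v.2 + s) ∈ f.vars)
    {A : List (DiffPoly K σ)} (hA : IsCharSet r I A) : A.length = 1 := by
  have hDchar := isCharSet_singleton hD hlead hdeg hI
  have hnot := hA.2 [D] hDchar.1.1 hDchar.1.2
  rcases A with _ | ⟨f, _ | ⟨g, A⟩⟩
  · exact (hnot trivial).elim
  · rfl
  · obtain ⟨w, hw⟩ := hA.1.1.1 f (by simp)
    have hDf : ¬ RankLT r D f := fun h => hnot (Or.inl h)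
    obtain ⟨s, hs⟩ := hI f (hA.1.2 f (by simp)) ⟨w, hw.1⟩
    have hwv : v = w := by
      rcases r.trichotomous v w with h | h | h
      · exact (hDf ⟨v, w, hlead, hw, Or.inl h⟩).elim
      · exact h
      · exact (not_lt_of_mem_vars hw hs h).elim
    subst hwv
    have h1 : ¬ MvPolynomial.degreeOf v D < MvPolynomial.degreeOf v f := fun h =>
      hDf ⟨v, v, hlead, hw, Or.inr ⟨rfl, h⟩⟩
    have h2 := hw.degreeOf_pos
    exact (hDchar.2 _ hA.1.1 hA.1.2 (Or.inr ⟨⟨v, hw, hlead, by omega⟩, trivial⟩)).elim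

end charSet

/-! ### The implicit ideal -/

section implicit

variable {K : Type*} [Field K] [Differential K] {m : ℕ} (a : Fin (m + 1) → K)
  (h : Fin (m + 1) → Fin m × ℕ →₀ K)

theorem diffSubst_affineSystem_X (p : Fin (m + 1) × ℕ) :
    diffSubst (affineSystem a h) (MvPolynomial.X p) =
      MvPolynomial.C ((Differential.deriv : K → K)^[p.2] (a p.1)) -
        linForm (formDeriv^[p.2] (h p.1)) := by
  rw [diffSubst, MvPolynomial.aeval_X, iterate_deriv_affineSystem]

theorem diffSubst_affineSystem_linForm (Q : Fin (m + 1) × ℕ →₀ K) :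
    diffSubst (affineSystem a h) (linForm Q) =
      MvPolynomial.C (Finsupp.linearCombination K
        (fun p => (Differential.deriv : K → K)^[p.2] (a p.1)) Q) - linForm (substForm h Q) := by
  induction Q using Finsupp.induction_linear with
  | zero => simp
  | add f g hf hg =>
    simp only [map_add, hf, hg]
    ring
  | single p b =>
    rw [linForm_single, map_mul, diffSubst_affineSystem_X, substForm,
      Finsupp.linearCombination_single, Finsupp.linearCombination_single, linForm_smul,
      smul_eq_mul, MvPolynomial.C_mul, MvPolynomial.algHom_C, MvPolynomial.algebraMap_eq]
    ring

/-- If the forms `∂^k h_i`, `(i, k) ∈ E`, are linearly independent, then the implicit ideal contains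
no nonzero polynomial in the `x_{i,k}`, `(i, k) ∈ E`: a linear left inverse of `x_{i,k} ↦ ∂^k h_i`
extends to a homomorphism of algebras whose composition with the substitution is the affine
involution `x_{i,k} ↦ ∂^k a_i - x_{i,k}`. -/
theorem eq_zero_of_mem_implicitIdeal {E : Set (Fin (m + 1) × ℕ)}
    (hE : ∀ Q : Fin (m + 1) × ℕ →₀ K, (∀ p, p ∉ E → Q p = 0) → substForm h Q = 0 → Q = 0)
    {g : DiffPoly K (Fin (m + 1))} (hg : ∀ p ∈ g.vars, p ∈ E)
    (h0 : g ∈ implicitIdeal (affineSystem a h)) : g = 0 := by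
  obtain ⟨φ, hφ⟩ := LinearMap.exists_leftInverse_of_injective (K := K)
    (V := Finsupp.supported K K E) (V' := Fin m × ℕ →₀ K)
    ((substForm h).domRestrict (Finsupp.supported K K E)) (by
      rw [LinearMap.ker_eq_bot']
      rintro ⟨Q, hQ⟩ hQ0
      exact Subtype.ext (hE Q ((Finsupp.mem_supported' K Q).1 hQ) hQ0))
  set φ' : (Fin m × ℕ →₀ K) →ₗ[K] (Fin (m + 1) × ℕ →₀ K) :=
    (Finsupp.supported K K E).subtype ∘ₗ φ
  have hφ' : ∀ p ∈ E, φ' (formDeriv^[p.2] (h p.1)) = Finsupp.single p 1 := by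
    intro p hp
    have := congrArg Subtype.val
      (LinearMap.congr_fun hφ ⟨Finsupp.single p 1, Finsupp.single_mem_supported K 1 hp⟩)
    simpa [φ', substForm] using this
  let Φ : DiffPoly K (Fin m) →ₐ[K] DiffPoly K (Fin (m + 1)) :=
    MvPolynomial.aeval fun v => linForm (φ' (Finsupp.single v 1))
  have hΦ : ∀ c, Φ (linForm c) = linForm (φ' c) := by
    intro c
    induction c using Finsupp.induction_linear with
    | zero => simp
    | add f g hf hg => simp only [map_add, hf, hg]
    | single v b =>
      rw [linForm, Finsupp.linearCombination_single, map_smul, MvPolynomial.aeval_X, ← mul_one b,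
        ← smul_eq_mul, ← Finsupp.smul_single, map_smul, map_smul, smul_eq_mul, mul_one]
  let Θ : DiffPoly K (Fin (m + 1)) →ₐ[K] DiffPoly K (Fin (m + 1)) :=
    MvPolynomial.aeval fun p =>
      MvPolynomial.C ((Differential.deriv : K → K)^[p.2] (a p.1)) - MvPolynomial.X p
  have hΘX : ∀ p, Θ (MvPolynomial.X p) =
      MvPolynomial.C ((Differential.deriv : K → K)^[p.2] (a p.1)) - MvPolynomial.X p := fun p =>
    MvPolynomial.aeval_X _ p
  have hΘΘ : Θ.comp Θ = AlgHom.id K _ := by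
    ext1 p
    rw [AlgHom.comp_apply, hΘX, map_sub, hΘX, MvPolynomial.algHom_C, MvPolynomial.algebraMap_eq,
      AlgHom.id_apply, sub_sub_cancel]
  have hcomp : Θ g = Φ (diffSubst (affineSystem a h) g) := by
    refine MvPolynomial.hom_congr_vars (f₁ := Θ.toRingHom)
      (f₂ := (Φ.comp (diffSubst (affineSystem a h))).toRingHom) ?_ ?_ rfl
    · ext1 b
      exact (Θ.commutes b).trans ((Φ.comp (diffSubst (affineSystem a h))).commutes b).symm
    · intro p hp _
      change Θ (MvPolynomial.X p) = Φ (diffSubst (affineSystem a h) (MvPolynomial.X p))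
      rw [hΘX, diffSubst_affineSystem_X, map_sub, hΦ, hφ' p (hg p hp), linForm_single,
        MvPolynomial.algHom_C, MvPolynomial.algebraMap_eq, map_one, one_mul]
  rw [implicitIdeal, RingHom.mem_ker] at h0
  rw [← AlgHom.id_apply (R := K) g, ← hΘΘ, AlgHom.comp_apply, hcomp, h0, map_zero, map_zero]

/-- If the differential homogeneous resultant does not vanish, and in the case `N = 0` neither does
the differential resultant, then the matrix of the leading coefficients of the `h_i` is
injective. -/
theorem eq_zero_of_leadingCoeff_mul_eq_zero
    (hres : homDiffRes (homPart (affineSystem a h)) ≠ 0)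
    (horder : 0 < ∑ i, formOrder (h i) ∨ diffRes (implicitForm (affineSystem a h)) ≠ 0)
    (z : Fin m → K) (hz : ∀ i, ∑ j, h i (j, formOrder (h i)) * z j = 0) : z = 0 := by
  -- `z` gives a functional on the forms of top order `t` that kills all `∂^k h_i`, `k + o_i ≤ t`
  have hpair : ∀ (t : ℕ) i k, k + formOrder (h i) ≤ t →
      Finsupp.linearCombination K (fun v : Fin m × ℕ => if v.2 = t then z v.1 else 0)
        (formDeriv^[k] (h i)) = 0 := by
    intro t i k hk
    rw [linearCombination_eq_sum_of_injective (f := fun j : Fin m => (j, t))]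
    · simp only [if_true]
      rcases hk.eq_or_lt with heq | hlt
      · rw [← hz i]
        exact Finset.sum_congr rfl fun j _ => by
          rw [iterate_formDeriv_apply_add apply_eq_zero_of_formOrder_lt heq]
      · exact Finset.sum_eq_zero fun j _ => by
          rw [iterate_formDeriv_eq_zero_of_lt apply_eq_zero_of_formOrder_lt hlt, zero_mul]
    · intro j j' hj
      exact (Prod.ext_iff.1 hj).1
    · rintro ⟨j, s⟩ hp
      rw [if_neg, mul_zero]
      rintro rfl
      exact hp ⟨j, rfl⟩
  ext j
  rcases Nat.eq_zero_or_pos (∑ i, formOrder (h i)) with hN | hN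
  · obtain ⟨Q₀, -, -, hD, hiff⟩ := diffRes_affineSystem a h
    have hQ₀ : Q₀ ≠ 0 := by
      rintro rfl
      refine (horder.resolve_left (by omega)) ?_
      rw [hD, map_zero, map_zero, map_zero, sub_zero]
    have := hiff.1 hQ₀ _ (fun i k hk => hpair 0 i k (hN ▸ hk)) (j, 0) (Nat.zero_le _)
    simpa using this
  · have := eq_zero_of_homDiffRes_ne_zero a h hres
      (fun i k hk => hpair (∑ i, formOrder (h i) - 1) i k (by omega))
      (j, ∑ i, formOrder (h i) - 1) (by simp only; omega)
    simpa using this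

/-- The forms `∂^k h_i`, `k + o_i ≤ N`, span the forms of order at most `N`: a functional `y` that
kills all of them vanishes below order `N` by the homogeneous resultant, and then in order `N` by the
leading coefficients. -/
theorem eq_zero_of_kills_iterate_formDeriv
    (hres : homDiffRes (homPart (affineSystem a h)) ≠ 0)
    (hlead : ∀ z : Fin m → K, (∀ i, ∑ j, h i (j, formOrder (h i)) * z j = 0) → z = 0)
    (y : Fin m × ℕ → K)
    (hy : ∀ i k, k + formOrder (h i) ≤ ∑ i, formOrder (h i) →
      Finsupp.linearCombination K y (formDeriv^[k] (h i)) = 0)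
    (v : Fin m × ℕ) (hv : v.2 ≤ ∑ i, formOrder (h i)) : y v = 0 := by
  have hlow := eq_zero_of_homDiffRes_ne_zero a h hres fun i k hk => hy i k hk.le
  have hle : ∀ i, formOrder (h i) ≤ ∑ i, formOrder (h i) := fun i =>
    Finset.single_le_sum (f := fun i => formOrder (h i)) (fun _ _ => Nat.zero_le _)
      (Finset.mem_univ i)
  have htop := hlead (fun j => y (j, ∑ i, formOrder (h i))) fun i => by
    have := hy i (∑ i, formOrder (h i) - formOrder (h i)) (Nat.sub_add_cancel (hle i)).le
    rw [linearCombination_eq_sum_of_injective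
      (f := fun j : Fin m => (j, ∑ i, formOrder (h i)))] at this
    · rw [← this]
      exact Finset.sum_congr rfl fun j _ => by
        rw [iterate_formDeriv_apply_add apply_eq_zero_of_formOrder_lt
          (Nat.sub_add_cancel (hle i))]
    · intro j j' hj
      exact (Prod.ext_iff.1 hj).1
    · rintro ⟨j, s⟩ hp
      rcases lt_trichotomy s (∑ i, formOrder (h i)) with hlt | rfl | hgt
      · rw [hlow (j, s) hlt, mul_zero]
      · exact (hp ⟨j, rfl⟩).elim
      · rw [iterate_formDeriv_eq_zero_of_lt apply_eq_zero_of_formOrder_lt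
          (by rwa [Nat.sub_add_cancel (hle i)]), zero_mul]
  obtain ⟨j, t⟩ := v
  rcases (show t ≤ _ from hv).eq_or_lt with rfl | hlt
  · exact congrFun htop j
  · exact hlow (j, t) hlt

theorem isImplicitEquation_affineSystem (hres : homDiffRes (homPart (affineSystem a h)) ≠ 0)
    (horder : 0 < ∑ i, formOrder (h i) ∨ diffRes (implicitForm (affineSystem a h)) ≠ 0)
    (r : Ranking (Fin (m + 1))) :
    IsImplicitEquation r (affineSystem a h) (diffRes (implicitForm (affineSystem a h))) := by
  have hlead := eq_zero_of_leadingCoeff_mul_eq_zero a h hres horder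
  obtain ⟨Q₀, hw₀, hrel₀, hD, hiff⟩ := diffRes_affineSystem a h
  have hQ₀ := hiff.2 (eq_zero_of_kills_iterate_formDeriv a h hres hlead)
  set D := diffRes (implicitForm (affineSystem a h))
  have hmem : D ∈ implicitIdeal (affineSystem a h) := by
    rw [implicitIdeal, RingHom.mem_ker, hD, map_sub, diffSubst_affineSystem_linForm, hrel₀,
      map_zero, sub_zero, MvPolynomial.algHom_C, MvPolynomial.algebraMap_eq, sub_self]
  rw [sub_eq_neg_add, ← map_neg] at hD
  have hvars : D.vars = Q₀.support := by rw [hD, vars_C_add_linForm]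
  obtain ⟨v, hv, hmax⟩ := r.exists_max (Finsupp.support_nonempty_iff.2 hQ₀)
  have hDv : IsLead r D v := by
    rw [IsLead, hvars]
    exact ⟨hv, hmax⟩
  have hdeg : MvPolynomial.degreeOf v D = 1 := by
    refine le_antisymm ((MvPolynomial.degreeOf_le_totalDegree _ _).trans ?_) hDv.degreeOf_pos
    rw [hD]
    exact totalDegree_C_add_linForm_le _ _
  have hI : ∀ f ∈ implicitIdeal (affineSystem a h), f.vars.Nonempty →
      ∃ s, (v.1, v.2 + s) ∈ f.vars := by
    intro f hf hne
    by_contra! hno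
    -- every nonzero relation involves a derivative of `v`
    have hf0 : f = 0 := eq_zero_of_mem_implicitIdeal a h
      (E := {p | ∀ s, p ≠ (v.1, v.2 + s)}) (fun Q hQ hrel => by
        obtain ⟨d, rfl⟩ := exists_linearCombination_iterate_formDeriv
          (fun i => Finset.single_le_sum (f := fun i => formOrder (h i))
            (fun _ _ => Nat.zero_le _) (Finset.mem_univ i))
          (fun i => apply_eq_zero_of_formOrder_lt)
          (fun Q => eq_zero_of_substForm_eq_zero a h hres) hlead hQ₀ hw₀ hrel₀ hrel
        by_contra hne
        obtain ⟨s, hs⟩ := exists_linearCombination_apply_ne_zero r (Finsupp.mem_support_iff.1 hv)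
          (fun w hw => hmax w (Finsupp.mem_support_iff.2 hw)) (d := d) (by
            rintro rfl
            exact hne (map_zero _))
        exact hs (hQ _ fun hE => hE s rfl))
      (fun p hp s hps => hno s (hps ▸ hp)) hf
    rw [hf0, MvPolynomial.vars_0] at hne
    exact Finset.not_nonempty_empty hne
  have hchar := isCharSet_singleton hmem hDv hdeg hI
  refine ⟨⟨⟨[D], hchar⟩, fun A hA => ?_⟩, ?_, hchar⟩
  · rw [length_eq_one_of_isCharSet hmem hDv hdeg hI hA, add_comm]
  · rw [hD]
    exact irreducible_C_add_linForm _ hQ₀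

end implicit

end DiffElim

end

theorem mainTheorem2 {K : Type*} [Field K] [Differential K] (m : ℕ)
    (P : Fin (m + 1) → DiffElim.DiffPoly K (Fin m))
    (hlin : ∀ i, (P i).totalDegree ≤ 1)
    (hnonconst : ∃ i, P i ∉ Set.range MvPolynomial.C)
    (hparam : ∀ j : Fin m, ∃ i, ∃ k : ℕ,
      MvPolynomial.coeff (Finsupp.single (j, k) 1) (P i) ≠ 0)
    (horder : 0 < DiffElim.totalOrder (DiffElim.homPart P) ∨
      DiffElim.diffRes (DiffElim.implicitForm P) ≠ 0)
    (hres : DiffElim.homDiffRes (DiffElim.homPart P) ≠ 0)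
    (r : DiffElim.Ranking (Fin (m + 1))) :
    DiffElim.HasDiffDim r (DiffElim.implicitIdeal P) m ∧
      DiffElim.IsImplicitEquation r P (DiffElim.diffRes (DiffElim.implicitForm P)) := by
  choose c hc using fun i => DiffElim.exists_eq_C_add_linForm (hlin i)
  obtain ⟨a, h, rfl⟩ : ∃ a h, P = DiffElim.affineSystem a h := by
    refine ⟨fun i => MvPolynomial.coeff 0 (P i), fun i => -c i, funext fun i => ?_⟩
    rw [DiffElim.affineSystem, map_neg, sub_neg_eq_add]
    exact hc i
  rw [DiffElim.totalOrder_homPart_affineSystem] at horder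
  have := DiffElim.isImplicitEquation_affineSystem a h hres horder r
  exact ⟨this.1, this⟩
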